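/- Let $G$ be a bipartite graph on $\Sigma_1=\{0,\dots,N-1\}$ with non-empty partition classes $V_1,V_2$ (each edge joins $V_1$ to $V_2$), $n_1=|V_1|$. Assume that every $x\in V_1$ has degree $d_1$ and that $d_2:=\max_{y\in V_2}\deg(y)\le d_1-1$. Let $G_n$ be the graph on the words of length $n$ over $\Sigma_1$ in which $x$ and $y$ are joined iff $x=y$, or, after deleting the longest common prefix, one of the two remaining words has all letters in $V_1$, the other has all letters in $V_2$, and each pair of corresponding letters is an edge of $G$. For a word $x=x_1\dots x_n$ let $I_x=\big[\sum_{r=1}^n x_rN^{-r},\ \sum_{r=1}^n x_rN^{-r}+N^{-n}\big]$, and let $\Lambda_n=\bigcup I_x\times I_y$, the union over all pairs $(x,y)$ joined in $G_n$. For each $n$ let $M_n=c_nN^n$ be an integer, where $\liminf_n c_n>0$ (for instance $c_n\equiv 1$ or $c_n\to\infty$). Let $X^{(0)},\dots,X^{(M_n)}$ be i.i.d. uniform on $[0,1]$, and let $G_n^{r}$ be the random graph on $\{0,\dots,M_n\}$ in which $i\ne j$ are joined iff $(X^{(i)},X^{(j)})\in\Lambda_n$ (loops are not counted). Let $V$ be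 a uniformly chosen vertex, independent of the points. Put $$\gamma=1+\frac{\log(N/n_1)}{\log d_1},\qquad t_k=\frac{d_1^{k+1}-1}{d_1-1},\qquad k_0(n)=\max\Big\{(n+1)\frac{\log d_2}{\log d_1},\ \frac{\log n}{\log d_1}\Big\}.$$ Then for every constant $K$ and all sufficiently large $n$ there is a function $L=L_n$ such that $$\mathbb P(\deg V>u)=\Big(\frac{u}{c_n}\Big)^{-(\gamma-1)}L(u),\qquad \frac{n_1}{N}\le L(u)\le\frac{N}{n_1},$$ for every real $u$ with $c_nt_k-K\sqrt{c_nt_k}\le u\le c_nt_n$ for some integer $k$ with $k_0(n)<k\le n$. (For $c_n\equiv1$ this reads $\mathbb P(\deg V>u)=u^{-(\gamma-1)}L(u)$.) -/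

import Mathlib

open MeasureTheory ProbabilityTheory Filter

namespace HierarchicalGraph

/-- The length of the longest common prefix of the words `x` and `y`. -/
def commonPrefixLength {N n : ℕ} (x y : Fin n → Fin N) : ℕ :=
  Nat.findGreatest (fun m => ∀ i : Fin n, i.val < m → x i = y i) n

/-- All letters of `x` after its first `m` letters belong to `S`. With `S = V₁` (resp. `S = V₂`)
this says that the postfix of `x` has type `1` (resp. type `2`). -/
def PostfixIn {N n : ℕ} (S : Finset (Fin N)) (x : Fin n → Fin N) (m : ℕ) : Prop :=
  ∀ i : Fin n, m ≤ i.val → x i ∈ S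

/-- The edge relation of the deterministic graph `G_n` on words of length `n`
(all loops included). -/
def IsEdge {N n : ℕ} (G : SimpleGraph (Fin N)) (V₁ V₂ : Finset (Fin N))
    (x y : Fin n → Fin N) : Prop :=
  x = y ∨
    (((PostfixIn V₁ x (commonPrefixLength x y) ∧ PostfixIn V₂ y (commonPrefixLength x y)) ∨
      (PostfixIn V₂ x (commonPrefixLength x y) ∧ PostfixIn V₁ y (commonPrefixLength x y))) ∧
      ∀ i : Fin n, commonPrefixLength x y ≤ i.val → G.Adj (x i) (y i))

theorem commonPrefixLength_comm {N n : ℕ} (x y : Fin n → Fin N) :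
    commonPrefixLength x y = commonPrefixLength y x := by
  unfold commonPrefixLength
  congr 1
  funext m
  simp only [eq_comm]

theorem IsEdge.symm {N n : ℕ} {G : SimpleGraph (Fin N)} {V₁ V₂ : Finset (Fin N)}
    {x y : Fin n → Fin N} (h : IsEdge G V₁ V₂ x y) : IsEdge G V₁ V₂ y x := by
  rcases h with h | ⟨h, hadj⟩
  · exact Or.inl h.symm
  · refine Or.inr ?_
    rw [commonPrefixLength_comm y x]
    refine ⟨?_, fun i hi => (hadj i hi).symm⟩
    rcases h with ⟨h1, h2⟩ | ⟨h1, h2⟩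
    · exact Or.inr ⟨h2, h1⟩
    · exact Or.inl ⟨h2, h1⟩

/-- The level-`n` `N`-adic interval `I_x` of the word `x = x₁ … x_n`
(the letter `x_r` is `x i` with `i = r - 1`). -/
noncomputable def adicInterval {N n : ℕ} (x : Fin n → Fin N) : Set ℝ :=
  Set.Icc (∑ i : Fin n, ((x i).val : ℝ) / (N : ℝ) ^ (i.val + 1))
    (∑ i : Fin n, ((x i).val : ℝ) / (N : ℝ) ^ (i.val + 1) + 1 / (N : ℝ) ^ n)

/-- The set `Λ_n`: the adjacency matrix of `G_n` embedded in the unit square, as the union of the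
level-`n` squares `I_x × I_y` over the edges `(x, y)` of `G_n`. -/
def embeddedAdjacency {N : ℕ} (G : SimpleGraph (Fin N)) (V₁ V₂ : Finset (Fin N)) (n : ℕ) :
    Set (ℝ × ℝ) :=
  {p | ∃ x y : Fin n → Fin N,
    IsEdge G V₁ V₂ x y ∧ p.1 ∈ adicInterval x ∧ p.2 ∈ adicInterval y}

/-- The graph `G_n^r` determined by the points `X i`: distinct `i`, `j` are joined when
`(X i, X j) ∈ Λ_n`. The ever-present loops are left out, as they are not counted in degrees. -/
def pointGraph {N : ℕ} (G : SimpleGraph (Fin N)) (V₁ V₂ : Finset (Fin N)) (n : ℕ)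
    {ι : Type*} (X : ι → ℝ) : SimpleGraph ι where
  Adj i j := i ≠ j ∧ (X i, X j) ∈ embeddedAdjacency G V₁ V₂ n
  symm := ⟨by
    rintro i j ⟨hne, x, y, he, hx, hy⟩
    exact ⟨hne.symm, y, x, he.symm, hy, hx⟩⟩
  loopless := ⟨fun _ h => h.1 rfl⟩

/-- The degree of the vertex `v` of `G_n^r`. -/
noncomputable def pointDegree {N : ℕ} (G : SimpleGraph (Fin N)) (V₁ V₂ : Finset (Fin N)) (n : ℕ)
    {ι : Type*} (X : ι → ℝ) (v : ι) : ℕ :=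
  ((pointGraph G V₁ V₂ n X).neighborSet v).ncard

/-- `t_k = (d₁^(k+1) - 1) / (d₁ - 1)`: the number of words joined in `G_n` (itself included) to a
word ending with a letter of `V₁` whose longest postfix of nonzero type has length `k`. -/
noncomputable def levelDegree (d₁ k : ℕ) : ℝ :=
  ((d₁ : ℝ) ^ (k + 1) - 1) / ((d₁ : ℝ) - 1)

/-- The threshold `k₀(n)`, above which the words of nonzero type `1` dominate the degrees. -/
noncomputable def levelThreshold (d₁ d₂ n : ℕ) : ℝ :=
  max (((n : ℝ) + 1) * (Real.log d₂ / Real.log d₁)) (Real.log n / Real.log d₁)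

/-- The exponent `γ = 1 + log (N / n₁) / log d₁`. -/
noncomputable def powerExponent (N n₁ d₁ : ℕ) : ℝ :=
  1 + Real.log ((N : ℝ) / n₁) / Real.log d₁

end HierarchicalGraph

/-! If the point of the chosen vertex lies in the interior of `I_x`, its degree is binomial with
mean `c_n` times the number of words joined to `x`. So the tail is an average of binomial tails over
words (`degree_tail_eq`). A word with exactly `j ≥ 1` trailing letters in `V₁` has `t_j` neighbours,
itself included; words with at least `j` such letters have mass `ρ^j`, where `ρ = n₁/N = d₁^(-g)`
and `g = γ - 1`. Words ending outside `V₁` have at most `∑ d₂^l ≤ d₁^k` neighbours, by the choice of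
`k₀(n)`. Hence the tail is about `ρ^j` for `u/c_n` between consecutive levels, and since `d₁^j ≤ t_j
≤ d₁^(j+1)` it is a power law up to a factor `ρ^{±1}`.

The exact constants need slack. With `v = u/c_n` the goal is `(d₁ v)^(-g) ≤ T ≤ (v/d₁)^(-g)`. Away
from the levels Chernoff errors suffice: `t_j ≥ (1 + 1/d₁) d₁^j` gives room below
(`lower_bound_of_lt`), and between levels the exponential error is beaten by the gain `μ^(-1/2)`
from staying one standard deviation below the next mean `μ` (`upper_bound_between`). Close to a
level a central limit theorem, uniform in the parameters, takes over. A binomial variable exceeds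
its mean with probability above `ρ < 1/2` (`exists_forall_le_degreeTail`), which settles the lower
bound at the top; it lies below its mean by `K` standard deviations with probability at least some
`δ > 0` (`exists_forall_wordTail_le`), which gives the upper bound in `upper_bound_near`. -/

namespace HierarchicalGraph

/-! ### Binomial counts: transforms and Chernoff bounds. -/

section Binomial

variable {Ω : Type*} [MeasurableSpace Ω] {P : Measure Ω} {ι : Type*}

/-- The number of the points `Y i ω`, `i ∈ s`, that lie in `A`, as a real number. -/
noncomputable def hits (s : Finset ι) (Y : ι → Ω → ℝ) (A : Set ℝ) (ω : Ω) : ℝ :=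
  ∑ i ∈ s, A.indicator 1 (Y i ω)

theorem measurable_hit {A : Set ℝ} (hA : MeasurableSet A) :
    Measurable (A.indicator (1 : ℝ → ℝ)) :=
  measurable_one.indicator hA

theorem measurable_hits {s : Finset ι} {Y : ι → Ω → ℝ} {A : Set ℝ}
    (hY : ∀ i, Measurable (Y i)) (hA : MeasurableSet A) : Measurable (hits s Y A) :=
  Finset.measurable_sum _ fun i _ => (measurable_hit hA).comp (hY i)

/-- An indicator takes only the values 0 and 1. The general target `E` serves both the real moment
generating function and the complex characteristic function. -/
theorem integral_hit {E : Type*} [NormedAddCommGroup E] [NormedSpace ℝ E] [CompleteSpace E]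
    [IsProbabilityMeasure P] {Y : Ω → ℝ} {A : Set ℝ} (hY : Measurable Y) (hA : MeasurableSet A)
    (f : ℝ → E) :
    ∫ ω, f (A.indicator 1 (Y ω)) ∂P
      = f 0 + P.real (Y ⁻¹' A) • (f 1 - f 0) := by
  have : (fun ω => f (A.indicator 1 (Y ω)))
      = fun ω => f 0 + (Y ⁻¹' A).indicator (fun _ => f 1 - f 0) ω := by
    funext ω
    by_cases h : Y ω ∈ A <;> simp [h]
  rw [this, integral_add (integrable_const _)
    ((integrable_const _).indicator (hY hA)), integral_indicator_const _ (hY hA)]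
  simp

theorem mgf_hits [IsProbabilityMeasure P] {s : Finset ι} {Y : ι → Ω → ℝ} {A : Set ℝ} {p : ℝ}
    (hY : ∀ i, Measurable (Y i)) (hA : MeasurableSet A) (hind : iIndepFun Y P)
    (hp : ∀ i, P.real (Y i ⁻¹' A) = p) (t : ℝ) :
    mgf (hits s Y A) P t = (1 + p * (Real.exp t - 1)) ^ s.card := by
  have h1 : hits s Y A = ∑ i ∈ s, (A.indicator 1 ∘ Y i) := by
    funext ω; simp [hits]
  rw [h1, (hind.comp (fun _ => A.indicator 1) fun _ => measurable_hit hA).mgf_sum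
    (fun i => (measurable_hit hA).comp (hY i))]
  refine (Finset.prod_congr rfl fun i _ => ?_).trans (Finset.prod_const _)
  have := integral_hit (P := P) (hY i) hA (fun x => Real.exp (t * x))
  simpa [mgf, hp] using this

theorem charFun_hits [IsProbabilityMeasure P] {s : Finset ι} {Y : ι → Ω → ℝ} {A : Set ℝ} {p : ℝ}
    (hY : ∀ i, Measurable (Y i)) (hA : MeasurableSet A) (hind : iIndepFun Y P)
    (hp : ∀ i, P.real (Y i ⁻¹' A) = p) (t : ℝ) :
    charFun (P.map (hits s Y A)) t
      = (1 + p * (Complex.exp (t * Complex.I) - 1)) ^ s.card := by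
  have h1 : hits s Y A = fun ω => ∑ i ∈ s, (A.indicator 1 ∘ Y i) ω := by
    funext ω; simp [hits]
  have hind' := (hind.comp (fun _ => A.indicator (1 : ℝ → ℝ)) fun _ => measurable_hit hA)
  rw [h1, (hind'.restrict s).charFun_map_fun_finsetSum_eq_prod
    (fun i _ => ((measurable_hit hA).comp (hY i)).aemeasurable)]
  rw [Finset.prod_apply]
  refine (Finset.prod_congr rfl fun i _ => ?_).trans (Finset.prod_const _)
  rw [charFun_apply_real, integral_map ((measurable_hit hA).comp (hY i)).aemeasurable (by fun_prop)]
  have := integral_hit (P := P) (hY i) hA (fun x : ℝ => Complex.exp (t * x * Complex.I))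
  simpa [hp] using this

theorem integrable_exp_hits [IsProbabilityMeasure P] {s : Finset ι} {Y : ι → Ω → ℝ} {A : Set ℝ}
    (hY : ∀ i, Measurable (Y i)) (hA : MeasurableSet A) (t : ℝ) :
    Integrable (fun ω => Real.exp (t * hits s Y A ω)) P := by
  refine Integrable.of_bound
    ((measurable_hits hY hA).const_mul t).exp.aestronglyMeasurable (Real.exp (|t| * s.card))
    (ae_of_all _ fun ω => ?_)
  rw [Real.norm_eq_abs, Real.abs_exp, Real.exp_le_exp]
  have h0 : |hits s Y A ω| ≤ s.card := by
    refine (Finset.abs_sum_le_sum_abs _ _).trans ?_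
    refine (Finset.sum_le_card_nsmul _ _ 1 fun i _ => ?_).trans (by simp)
    by_cases h : Y i ω ∈ A <;> simp [h]
  calc t * hits s Y A ω ≤ |t| * |hits s Y A ω| := by rw [← abs_mul]; exact le_abs_self _
    _ ≤ _ := by gcongr

/-- Combines `e^t - 1 ≤ t + t²` on `|t| ≤ 1` with `1 + x ≤ e^x`; the two signs of `t` serve the two
tails. -/
theorem mgf_hits_le [IsProbabilityMeasure P] {s : Finset ι} {Y : ι → Ω → ℝ} {A : Set ℝ} {p : ℝ}
    (hY : ∀ i, Measurable (Y i)) (hA : MeasurableSet A) (hind : iIndepFun Y P)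
    (hp : ∀ i, P.real (Y i ⁻¹' A) = p) (hp0 : 0 ≤ p) (hp1 : p ≤ 1) {t : ℝ} (ht : |t| ≤ 1) :
    mgf (hits s Y A) P t ≤ Real.exp (s.card * p * (t + t ^ 2)) := by
  rw [mgf_hits hY hA hind hp]
  have h1 : Real.exp t - 1 ≤ t + t ^ 2 := by
    have := (abs_le.1 (Real.abs_exp_sub_one_sub_id_le ht)).2
    linarith
  have h2 : 0 ≤ 1 + p * (Real.exp t - 1) := by nlinarith [Real.exp_pos t]
  calc (1 + p * (Real.exp t - 1)) ^ s.card ≤ (Real.exp (p * (t + t ^ 2))) ^ s.card := by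
        gcongr
        have := Real.add_one_le_exp (p * (t + t ^ 2))
        nlinarith
    _ = _ := by rw [← Real.exp_nat_mul]; ring_nf

/-- Chernoff's bound for the upper tail of a binomial variable. -/
theorem hits_upper_tail [IsProbabilityMeasure P] {s : Finset ι} {Y : ι → Ω → ℝ} {A : Set ℝ}
    {p m η : ℝ} (hY : ∀ i, Measurable (Y i)) (hA : MeasurableSet A) (hind : iIndepFun Y P)
    (hp : ∀ i, P.real (Y i ⁻¹' A) = p) (hp0 : 0 ≤ p) (hp1 : p ≤ 1) (hm : s.card * p ≤ m)
    (hη0 : 0 ≤ η) (hη1 : η ≤ 1) :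
    P.real {ω | (1 + η) * m ≤ hits s Y A ω} ≤ Real.exp (-(η ^ 2 / 4 * m)) := by
  -- `t = η/2` minimises the exponent `-t(1 + η) + t + t²`, with value `-η²/4`.
  refine (measure_ge_le_exp_mul_mgf ((1 + η) * m) (t := η / 2) (by positivity)
    (integrable_exp_hits hY hA _)).trans ?_
  calc _ ≤ Real.exp (-(η / 2) * ((1 + η) * m)) * Real.exp (s.card * p * (η / 2 + (η / 2) ^ 2)) := by
        gcongr
        exact mgf_hits_le hY hA hind hp hp0 hp1 (by rw [abs_of_nonneg] <;> linarith)
    _ ≤ _ := by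
        rw [← Real.exp_add, Real.exp_le_exp]
        have : s.card * p * (η / 2 + (η / 2) ^ 2) ≤ m * (η / 2 + (η / 2) ^ 2) := by gcongr
        nlinarith

/-- Chernoff's bound for the lower tail of a binomial variable. -/
theorem hits_lower_tail [IsProbabilityMeasure P] {s : Finset ι} {Y : ι → Ω → ℝ} {A : Set ℝ}
    {p m η : ℝ} (hY : ∀ i, Measurable (Y i)) (hA : MeasurableSet A) (hind : iIndepFun Y P)
    (hp : ∀ i, P.real (Y i ⁻¹' A) = p) (hp0 : 0 ≤ p) (hp1 : p ≤ 1) (hm : m ≤ s.card * p)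
    (hη0 : 0 ≤ η) (hη1 : η ≤ 1) :
    P.real {ω | hits s Y A ω ≤ (1 - η) * m} ≤ Real.exp (-(η ^ 2 / 4 * m)) := by
  refine (measure_le_le_exp_mul_mgf ((1 - η) * m) (t := -(η / 2)) (by linarith)
    (integrable_exp_hits hY hA _)).trans ?_
  calc _ ≤ Real.exp (-(-(η / 2)) * ((1 - η) * m)) *
        Real.exp (s.card * p * (-(η / 2) + (-(η / 2)) ^ 2)) := by
        gcongr
        exact mgf_hits_le hY hA hind hp hp0 hp1 (by rw [abs_neg, abs_of_nonneg] <;> linarith)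
    _ ≤ _ := by
        rw [← Real.exp_add, Real.exp_le_exp]
        have h1 : 0 ≤ η / 2 - (η / 2) ^ 2 := by nlinarith
        have : m * (η / 2 - (η / 2) ^ 2) ≤ s.card * p * (η / 2 - (η / 2) ^ 2) := by gcongr
        nlinarith

end Binomial

/-! ### A central limit theorem for rare events, uniform in the parameters. -/

section PoissonCLT

open Topology

theorem norm_pow_sub_pow_le_mul {a b : ℂ} (ha : ‖a‖ ≤ 1) (hb : ‖b‖ ≤ 1) (m : ℕ) :
    ‖a ^ m - b ^ m‖ ≤ m * ‖a - b‖ := by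
  induction m with
  | zero => simp
  | succ m ih =>
    have : a ^ (m + 1) - b ^ (m + 1) = (a ^ m - b ^ m) * a + b ^ m * (a - b) := by ring
    rw [this]
    calc _ ≤ ‖a ^ m - b ^ m‖ * ‖a‖ + ‖b‖ ^ m * ‖a - b‖ := by
          refine (norm_add_le _ _).trans (le_of_eq ?_)
          simp
      _ ≤ (m * ‖a - b‖) * 1 + 1 * ‖a - b‖ := by
          gcongr
          exact pow_le_one₀ (norm_nonneg _) hb
      _ = _ := by push_cast; ring

theorem norm_exp_mul_I_sub_one_le (s : ℝ) : ‖Complex.exp (s * Complex.I) - 1‖ ≤ |s| := by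
  have := Real.norm_exp_I_mul_ofReal_sub_one_le (x := s)
  rwa [mul_comm, Real.norm_eq_abs] at this

/-- Poisson approximation: `1 + z` and `e^z` both lie in the unit disc, so the powers differ by at
most `m |e^z - 1 - z| ≤ m |z|²`. At `s = t/√(mp)` the bound is `t² p`. -/
theorem norm_bernoulli_pow_sub_exp_le {p s : ℝ} (hp0 : 0 ≤ p) (hp1 : p ≤ 1) (hs : |s| ≤ 1)
    (m : ℕ) :
    ‖(1 + p * (Complex.exp (s * Complex.I) - 1)) ^ m
      - Complex.exp (m * p * (Complex.exp (s * Complex.I) - 1))‖ ≤ m * (p * s) ^ 2 := by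
  set z : ℂ := p * (Complex.exp (s * Complex.I) - 1) with hz
  have hzn : ‖z‖ ≤ p * |s| := by
    rw [hz, norm_mul, Complex.norm_real, Real.norm_of_nonneg hp0]
    gcongr
    exact norm_exp_mul_I_sub_one_le s
  have hz1 : ‖z‖ ≤ 1 := hzn.trans (mul_le_one₀ hp1 (abs_nonneg _) hs)
  have hE : ‖Complex.exp (s * Complex.I)‖ = 1 := Complex.norm_exp_ofReal_mul_I s
  have ha : ‖1 + z‖ ≤ 1 := by
    have : 1 + z = (1 - p : ℝ) + (p : ℝ) * Complex.exp (s * Complex.I) := by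
      rw [hz]; push_cast; ring
    rw [this]
    refine (norm_add_le _ _).trans ?_
    rw [norm_mul, hE, Complex.norm_real, Complex.norm_real, Real.norm_of_nonneg hp0,
      Real.norm_of_nonneg (by linarith)]
    linarith
  have hb : ‖Complex.exp z‖ ≤ 1 := by
    rw [Complex.norm_exp, Real.exp_le_one_iff, hz, Complex.re_ofReal_mul]
    have := Complex.re_le_norm (Complex.exp (s * Complex.I))
    rw [hE] at this
    simp only [Complex.sub_re, Complex.one_re]
    nlinarith
  have hm : Complex.exp (m * p * (Complex.exp (s * Complex.I) - 1)) = Complex.exp z ^ m := by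
    rw [← Complex.exp_nat_mul, hz]; ring_nf
  rw [hm]
  refine (norm_pow_sub_pow_le_mul ha hb m).trans ?_
  gcongr
  rw [← norm_neg]
  have : -(1 + z - Complex.exp z) = Complex.exp z - 1 - z := by ring
  rw [this]
  refine (Complex.norm_exp_sub_one_sub_id_le hz1).trans ?_
  calc ‖z‖ ^ 2 ≤ (p * |s|) ^ 2 := by gcongr
    _ = _ := by rw [mul_pow, mul_pow, sq_abs]

theorem norm_exp_mul_I_taylor_two {s : ℝ} (hs : |s| ≤ 1) :
    ‖Complex.exp (s * Complex.I) - 1 - s * Complex.I + s ^ 2 / 2‖ ≤ |s| ^ 3 := by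
  have hn : ‖(s : ℂ) * Complex.I‖ = |s| := by simp
  have := Complex.exp_bound (x := s * Complex.I) (by rw [hn]; exact hs) (n := 3) (by norm_num)
  rw [hn] at this
  have h2 : Complex.exp (s * Complex.I) - 1 - s * Complex.I + s ^ 2 / 2
      = Complex.exp (s * Complex.I) - ∑ m ∈ Finset.range 3, (s * Complex.I) ^ m / m.factorial := by
    simp only [Finset.sum_range_succ, Finset.sum_range_zero, Nat.factorial, mul_pow, Complex.I_sq]
    push_cast
    ring
  rw [h2]
  refine this.trans ?_
  have : ((Nat.succ 3 : ℕ) : ℝ) * (((Nat.factorial 3 : ℕ) : ℝ) * (3 : ℕ))⁻¹ ≤ 1 := by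
    norm_num [Nat.factorial]
  have h3 : 0 ≤ |s| ^ 3 := by positivity
  nlinarith

/-- The centred Poisson exponent `m (e^{is} - 1 - is)` tends to `-t²/2` by Taylor expansion, and the
Poisson approximation costs only `t² p`. -/
theorem tendsto_charFun_centered_binomial {M : ℕ → ℕ} {p : ℕ → ℝ} (hp0 : ∀ k, 0 ≤ p k)
    (hp : Tendsto p atTop (𝓝 0)) (hM : Tendsto (fun k => (M k : ℝ) * p k) atTop atTop) (t : ℝ) :
    Tendsto (fun k => Complex.exp (-(t * √(M k * p k) : ℝ) * Complex.I) *
      (1 + p k * (Complex.exp ((t / √(M k * p k) : ℝ) * Complex.I) - 1)) ^ M k) atTop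
      (𝓝 (Complex.exp (-t ^ 2 / 2))) := by
  set m : ℕ → ℝ := fun k => M k * p k with hm
  set s : ℕ → ℝ := fun k => t / √(m k) with hs
  have hsq : Tendsto (fun k => √(m k)) atTop atTop := Real.tendsto_sqrt_atTop.comp hM
  have hs0 : Tendsto s atTop (𝓝 0) := tendsto_const_nhds.div_atTop hsq
  have hs1 : ∀ᶠ k in atTop, |s k| ≤ 1 := by
    have := (continuous_abs.tendsto (0 : ℝ)).comp hs0
    rw [abs_zero] at this
    exact this.eventually_le_const zero_lt_one
  have hm1 : ∀ᶠ k in atTop, 0 < m k := hM.eventually_gt_atTop 0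
  have hp1 : ∀ᶠ k in atTop, p k ≤ 1 := hp.eventually_le_const zero_lt_one
  have hexp : Tendsto (fun k => (m k : ℂ) * (Complex.exp (s k * Complex.I) - 1 - s k * Complex.I))
      atTop (𝓝 (-t ^ 2 / 2)) := by
    rw [tendsto_iff_norm_sub_tendsto_zero]
    refine squeeze_zero' (g := fun k => t ^ 2 * |s k|) (Eventually.of_forall fun _ => norm_nonneg _)
      ?_ ?_
    · filter_upwards [hs1, hm1] with k h1 h2
      have hms : m k * s k ^ 2 = t ^ 2 := by
        simp only [hs, div_pow]
        rw [Real.sq_sqrt h2.le]; field_simp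
      have hms' : (m k : ℂ) * (s k : ℂ) ^ 2 = (t : ℂ) ^ 2 := by exact_mod_cast hms
      have : (m k : ℂ) * (Complex.exp (s k * Complex.I) - 1 - s k * Complex.I) - -(t : ℂ) ^ 2 / 2
          = m k * (Complex.exp (s k * Complex.I) - 1 - s k * Complex.I + s k ^ 2 / 2) := by
        rw [← hms']; ring
      rw [this, norm_mul, Complex.norm_real, Real.norm_of_nonneg h2.le, ← hms]
      calc _ ≤ m k * |s k| ^ 3 := by gcongr; exact norm_exp_mul_I_taylor_two h1
        _ = _ := by rw [← sq_abs (s k)]; ring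
    · have := (hs0.abs).const_mul (t ^ 2)
      simpa using this
  have hlim := (Complex.continuous_exp.tendsto _).comp hexp
  refine hlim.congr_dist ?_
  refine squeeze_zero' (g := fun k => t ^ 2 * p k) (Eventually.of_forall fun _ => dist_nonneg) ?_ ?_
  · filter_upwards [hs1, hm1, hp1] with k h1 h2 h3
    have hms : m k * s k = t * √(m k) := by
      simp only [hs]
      have := Real.mul_self_sqrt h2.le
      have h4 := (Real.sqrt_pos.2 h2).ne'
      field_simp
      rw [sq, this, mul_comm]
    have hms2 : m k * s k ^ 2 = t ^ 2 := by
      simp only [hs, div_pow]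
      rw [Real.sq_sqrt h2.le]; field_simp
    have h5 : Complex.exp (m k * (Complex.exp (s k * Complex.I) - 1 - s k * Complex.I))
        = Complex.exp (-(t * √(m k) : ℝ) * Complex.I) *
          Complex.exp (M k * p k * (Complex.exp (s k * Complex.I) - 1)) := by
      rw [← Complex.exp_add, ← hms]
      congr 1
      simp only [hm]
      push_cast
      ring
    rw [dist_comm, dist_eq_norm, Function.comp, h5, ← mul_sub, norm_mul]
    have h6 : ‖Complex.exp (-(t * √(m k) : ℝ) * Complex.I)‖ = 1 := by
      rw [← Complex.ofReal_neg, Complex.norm_exp_ofReal_mul_I]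
    rw [h6, one_mul]
    refine (norm_bernoulli_pow_sub_exp_le (hp0 k) h3 h1 (M k)).trans (le_of_eq ?_)
    rw [← hms2]
    simp only [hm]
    ring
  · simpa using hp.const_mul (t ^ 2)

/-- The central limit theorem for binomial laws with small success probability, uniformly in the
parameters: `κ` is the law of a binomial variable, given by its characteristic function. -/
theorem exists_forall_lt_binomial_open {U : Set ℝ} (hU : IsOpen U) {r : ℝ}
    (hr : r < (gaussianReal 0 1).real U) :
    ∃ m₀ p₀ : ℝ, 0 < p₀ ∧ ∀ (M : ℕ) (p : ℝ) (κ : Measure ℝ), IsProbabilityMeasure κ →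
      0 ≤ p → p ≤ p₀ → m₀ ≤ M * p →
      (∀ t : ℝ, charFun κ t = (1 + p * (Complex.exp (t * Complex.I) - 1)) ^ M) →
      r < κ.real {x | (x - M * p) / √(M * p) ∈ U} := by
  -- Uniformity by compactness: failure for `m₀ = k`, `p₀ = 1/(k+1)` and every `k` produces a
  -- sequence of laws contradicting the limit theorem.
  by_contra! hcon
  choose M p κ hκ hp0 hp1 hm hchar hle using
    fun k : ℕ => hcon k (1 / ((k : ℝ) + 1)) Nat.one_div_pos_of_nat
  have hp : Tendsto p atTop (𝓝 0) :=
    squeeze_zero hp0 hp1 tendsto_one_div_add_atTop_nhds_zero_nat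
  have hmt : Tendsto (fun k => (M k : ℝ) * p k) atTop atTop :=
    tendsto_atTop_mono hm tendsto_natCast_atTop_atTop
  have hmeas : ∀ k, Measurable fun x : ℝ => (√(M k * p k))⁻¹ * x + -√(M k * p k) := by
    intro k; fun_prop
  let Z : ℕ → ProbabilityMeasure ℝ := fun k =>
    ⟨(κ k).map fun x => (√(M k * p k))⁻¹ * x + -√(M k * p k),
      Measure.isProbabilityMeasure_map (hmeas k).aemeasurable⟩
  let g : ProbabilityMeasure ℝ := ⟨gaussianReal 0 1, inferInstance⟩
  have hlim : Tendsto Z atTop (𝓝 g) := by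
    refine ProbabilityMeasure.tendsto_of_tendsto_charFun fun t => ?_
    have hg : charFun (g : Measure ℝ) t = Complex.exp (-t ^ 2 / 2) := by
      change charFun (gaussianReal 0 1) t = _
      rw [charFun_gaussianReal]
      congr 1
      push_cast
      ring
    rw [hg]
    refine (tendsto_charFun_centered_binomial hp0 hp hmt t).congr fun k => ?_
    change _ = charFun ((κ k).map fun x => (√(M k * p k))⁻¹ * x + -√(M k * p k)) t
    have hcomp : (κ k).map (fun x => (√(M k * p k))⁻¹ * x + -√(M k * p k))
        = ((κ k).map fun x => (√(M k * p k))⁻¹ * x).map (fun x => x + -√(M k * p k)) := by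
      rw [Measure.map_map (by fun_prop) (by fun_prop)]; rfl
    rw [hcomp, charFun_map_add_const, charFun_map_mul, hchar, mul_comm]
    congr 1
    · congr 3
      push_cast
      ring_nf
    · simp
  -- Portmanteau for open sets: the Gaussian mass of `U` is at most the lower limit of masses
  -- bounded by `r`.
  have hlimU := ProbabilityMeasure.le_liminf_measure_open_of_tendsto hlim hU
  have hev : ∀ k, (Z k : Measure ℝ) U ≤ ENNReal.ofReal r := by
    intro k
    have : (Z k : Measure ℝ) U = κ k {x | (x - M k * p k) / √(M k * p k) ∈ U} := by
      change (κ k).map _ U = _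
      rw [Measure.map_apply (hmeas k) hU.measurableSet]
      congr 1
      ext x
      simp only [Set.mem_preimage, Set.mem_ofPred_eq]
      rw [sub_div, Real.div_sqrt, div_eq_inv_mul, sub_eq_add_neg]
    rw [this, ← ofReal_measureReal (μ := κ k)]
    exact ENNReal.ofReal_le_ofReal (hle k)
  have : (gaussianReal 0 1) U ≤ ENNReal.ofReal r := by
    refine hlimU.trans ?_
    refine (liminf_le_liminf (Eventually.of_forall hev)).trans ?_
    rw [liminf_const]
  -- Needed because `ENNReal.ofReal` truncates negative numbers.
  have hr0 : 0 ≤ r := measureReal_nonneg.trans (hle 0)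
  have h2 : (gaussianReal 0 1).real U ≤ r := ENNReal.toReal_le_of_le_ofReal hr0 this
  linarith

theorem gaussianReal_real_Ioi_zero : (gaussianReal 0 1).real (Set.Ioi 0) = 1 / 2 := by
  have : NullSingletonClass (gaussianReal 0 1) := nullSingletonClass_gaussianReal one_ne_zero
  have h1 : (gaussianReal 0 1).real (Set.Iio 0) = (gaussianReal 0 1).real (Set.Ioi 0) := by
    have h := gaussianReal_map_neg (μ := 0) (v := 1)
    rw [neg_zero] at h
    conv_rhs => rw [← h]
    rw [map_measureReal_apply measurable_neg measurableSet_Ioi]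
    congr 1
    ext x; simp
  have h3 : (gaussianReal 0 1).real (Set.Ioi 0)ᶜ = 1 - (gaussianReal 0 1).real (Set.Ioi 0) :=
    probReal_compl_eq_one_sub measurableSet_Ioi
  rw [Set.compl_Ioi, measureReal_congr Iio_ae_eq_Iic.symm, h1] at h3
  linarith

theorem gaussianReal_real_Iio_pos (x : ℝ) : 0 < (gaussianReal 0 1).real (Set.Iio x) := by
  refine ENNReal.toReal_pos (fun h => ?_) (measure_ne_top _ _)
  have := gaussianReal_absolutelyContinuous' 0 (v := 1) one_ne_zero h
  simp at this

/-- The central limit theorem for the number of hits of a rare set. -/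
theorem exists_forall_lt_hits_open {U : Set ℝ} (hU : IsOpen U) {r : ℝ}
    (hr : r < (gaussianReal 0 1).real U) :
    ∃ m₀ p₀ : ℝ, 0 < p₀ ∧ ∀ {Ω : Type*} [MeasurableSpace Ω] (P : Measure Ω)
      [IsProbabilityMeasure P] {ι : Type*} (s : Finset ι) (Y : ι → Ω → ℝ) (A : Set ℝ) (p : ℝ),
      (∀ i, Measurable (Y i)) → MeasurableSet A → iIndepFun Y P →
      (∀ i, P.real (Y i ⁻¹' A) = p) → 0 ≤ p → p ≤ p₀ → m₀ ≤ s.card * p →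
      r < P.real {ω | (hits s Y A ω - s.card * p) / √(s.card * p) ∈ U} := by
  obtain ⟨m₀, p₀, hp₀, h⟩ := exists_forall_lt_binomial_open hU hr
  refine ⟨m₀, p₀, hp₀, fun P _ _ s Y A p hY hA hind hp hp0 hp1 hm => ?_⟩
  have h1 := h s.card p (P.map (hits s Y A))
    (Measure.isProbabilityMeasure_map (measurable_hits hY hA).aemeasurable) hp0 hp1 hm
    (charFun_hits hY hA hind hp)
  rwa [map_measureReal_apply (measurable_hits hY hA)] at h1
  exact (by fun_prop : Measurable fun x : ℝ => (x - s.card * p) / √(s.card * p)) hU.measurableSet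

end PoissonCLT

/-! ### Counting the words joined to a given word. -/

section Combinatorics

variable {N n : ℕ} {G : SimpleGraph (Fin N)} {V₁ V₂ : Finset (Fin N)}

theorem prod_fin_ite_lt {R : Type*} [CommMonoid R] {n l : ℕ} (hl : l ≤ n) (x y : R) :
    ∏ i : Fin n, (if i.val < n - l then x else y) = x ^ (n - l) * y ^ l := by
  rw [Fin.prod_univ_eq_prod_range (fun i => if i < n - l then x else y) n]
  conv_lhs => rw [← Nat.sub_add_cancel hl, Finset.prod_range_add]
  congr 1
  · rw [Finset.prod_congr rfl (g := fun _ => x) (by intro i hi; simp_all)]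
    simp
  · rw [Finset.prod_congr rfl (g := fun _ => y) (by intro i _; simp)]
    simp

theorem PostfixIn.mono {S : Finset (Fin N)} {x : Fin n → Fin N} {m m' : ℕ}
    (h : PostfixIn S x m) (hm : m ≤ m') : PostfixIn S x m' :=
  fun i hi => h i (hm.trans hi)

/-- Adjacency forces the type of the second postfix, and irreflexivity forces `m` to be the common
prefix length. The case `m = n` is the loop. -/
theorem isEdge_iff (hG : G.IsBipartiteWith (V₁ : Set (Fin N)) (V₂ : Set (Fin N)))
    {x y : Fin n → Fin N} :
    IsEdge G V₁ V₂ x y ↔ ∃ m ≤ n, (PostfixIn V₁ x m ∨ PostfixIn V₂ x m) ∧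
      ∀ i : Fin n, if i.val < m then y i = x i else G.Adj (x i) (y i) := by
  constructor
  · rintro (rfl | ⟨h, hadj⟩)
    · exact ⟨n, le_rfl, Or.inl fun i hi => absurd i.2 hi.not_gt, fun i => by simp⟩
    · refine ⟨commonPrefixLength x y, Nat.findGreatest_le n, h.imp And.left And.left, fun i => ?_⟩
      split_ifs with hi
      · have := Nat.findGreatest_spec (P := fun m => ∀ i : Fin n, i.val < m → x i = y i)
          (m := 0) (n := n) (Nat.zero_le _) (by simp)
        exact (this i hi).symm
      · exact hadj i (not_lt.1 hi)
  · rintro ⟨m, hm, hpost, h⟩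
    rcases hm.eq_or_lt with rfl | hlt
    · exact Or.inl (funext fun i => by simpa [eq_comm] using h i)
    have hadj : ∀ i : Fin n, m ≤ i.val → G.Adj (x i) (y i) := fun i hi => by
      simpa [hi.not_gt] using h i
    have hc : commonPrefixLength x y = m := by
      refine Nat.findGreatest_eq_iff.2 ⟨hm, fun _ i hi => ?_, fun k hk hkn hP => ?_⟩
      · simpa [hi, eq_comm] using h i
      · exact (hadj ⟨m, hlt⟩ le_rfl).ne (hP ⟨m, hlt⟩ hk)
    refine Or.inr ?_
    rw [hc]
    refine ⟨?_, hadj⟩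
    rcases hpost with hp | hp
    · exact Or.inl ⟨hp, fun i hi => hG.mem_of_mem_adj (hp i hi) (hadj i hi)⟩
    · exact Or.inr ⟨hp, fun i hi => hG.symm.mem_of_mem_adj (hp i hi) (hadj i hi)⟩

open Classical in
/-- The words joined to `x` in `G_n`, including `x`. -/
noncomputable def closedNeighbors (G : SimpleGraph (Fin N)) (V₁ V₂ : Finset (Fin N))
    (x : Fin n → Fin N) : Finset (Fin n → Fin N) :=
  Finset.univ.filter (IsEdge G V₁ V₂ x)

theorem mem_closedNeighbors {x y : Fin n → Fin N} :
    y ∈ closedNeighbors G V₁ V₂ x ↔ IsEdge G V₁ V₂ x y := by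
  simp [closedNeighbors]

variable [DecidableRel G.Adj]

open Classical in
/-- The number of neighbours of `x` that differ from `x` exactly in the last `l` letters. -/
noncomputable def levelCount (G : SimpleGraph (Fin N)) [DecidableRel G.Adj]
    (V₁ V₂ : Finset (Fin N)) (x : Fin n → Fin N) (l : ℕ) : ℕ :=
  if PostfixIn V₁ x (n - l) ∨ PostfixIn V₂ x (n - l) then
    ∏ i : Fin n, (if i.val < n - l then 1 else G.degree (x i)) else 0

/-- The neighbours are sorted by the number `l` of trailing letters that change; each class is a
product of neighbourhoods. -/
theorem card_closedNeighbors (hG : G.IsBipartiteWith (V₁ : Set (Fin N)) (V₂ : Set (Fin N)))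
    (x : Fin n → Fin N) :
    (closedNeighbors G V₁ V₂ x).card = ∑ l ∈ Finset.range (n + 1), levelCount G V₁ V₂ x l := by
  classical
  let E : ℕ → Finset (Fin n → Fin N) := fun l =>
    if PostfixIn V₁ x (n - l) ∨ PostfixIn V₂ x (n - l) then
      Fintype.piFinset fun i => if i.val < n - l then {x i} else G.neighborFinset (x i) else ∅
  have hE : ∀ l y, y ∈ E l ↔ (PostfixIn V₁ x (n - l) ∨ PostfixIn V₂ x (n - l)) ∧
      ∀ i : Fin n, if i.val < n - l then y i = x i else G.Adj (x i) (y i) := by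
    intro l y
    simp only [E]
    split_ifs with h
    · rw [Fintype.mem_piFinset]
      refine ⟨fun h' => ⟨h, fun i => ?_⟩, fun h' i => ?_⟩
      · have := h' i
        split_ifs at this ⊢ <;> simpa using this
      · have := h'.2 i
        split_ifs at this ⊢ <;> simpa using this
    · simp [h]
  have hU : closedNeighbors G V₁ V₂ x = (Finset.range (n + 1)).biUnion E := by
    ext y
    rw [mem_closedNeighbors, isEdge_iff hG, Finset.mem_biUnion]
    constructor
    · rintro ⟨m, hm, h⟩
      refine ⟨n - m, by simp, (hE _ _).2 ?_⟩
      rwa [Nat.sub_sub_self hm]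
    · rintro ⟨l, hl, h⟩
      exact ⟨n - l, Nat.sub_le _ _, (hE _ _).1 h⟩
  have hdisj : ∀ l ∈ Finset.range (n + 1), ∀ l' ∈ Finset.range (n + 1), l < l' →
      Disjoint (E l) (E l') := by
    intro l hl l' hl' hlt
    rw [Finset.disjoint_left]
    intro y hy hy'
    rw [Finset.mem_range] at hl hl'
    -- At position `n - l'` the smaller level says that the letters agree, the larger one that they
    -- are adjacent.
    have h1 := ((hE _ _).1 hy).2 ⟨n - l', by omega⟩
    have h2 := ((hE _ _).1 hy').2 ⟨n - l', by omega⟩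
    rw [if_pos (by simp only; omega)] at h1
    rw [if_neg (by simp), h1] at h2
    exact G.irrefl h2
  rw [hU, Finset.card_biUnion]
  · refine Finset.sum_congr rfl fun l _ => ?_
    simp only [E, levelCount]
    split_ifs with h
    · rw [Fintype.card_piFinset]
      refine Finset.prod_congr rfl fun i _ => ?_
      split_ifs <;> simp
    · simp
  · intro l hl l' hl' hne
    rcases lt_or_gt_of_ne hne with h | h
    · exact hdisj l hl l' hl' h
    · exact (hdisj l' hl' l hl h).symm

theorem levelCount_of_postfixIn {d₁ : ℕ} (hd₁ : ∀ x ∈ V₁, G.degree x = d₁) {x : Fin n → Fin N}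
    {l : ℕ} (hl : l ≤ n) (h : PostfixIn V₁ x (n - l)) : levelCount G V₁ V₂ x l = d₁ ^ l := by
  rw [levelCount, if_pos (Or.inl h)]
  have := prod_fin_ite_lt hl 1 d₁
  rw [one_pow, one_mul] at this
  rw [← this]
  refine Finset.prod_congr rfl fun i _ => ?_
  split_ifs with hi
  · rfl
  · exact hd₁ _ (h i (not_lt.1 hi))

theorem levelCount_le_of_not_postfixIn {d₂ : ℕ} (hd₂ : ∀ x ∈ V₂, G.degree x ≤ d₂)
    {x : Fin n → Fin N} {l : ℕ} (hl : l ≤ n) (h : ¬ PostfixIn V₁ x (n - l)) :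
    levelCount G V₁ V₂ x l ≤ d₂ ^ l := by
  rw [levelCount]
  split_ifs with h'
  · have h' := h'.resolve_left h
    have := prod_fin_ite_lt hl 1 d₂
    rw [one_pow, one_mul] at this
    rw [← this]
    refine Finset.prod_le_prod' fun i _ => ?_
    split_ifs with hi
    · exact le_rfl
    · exact hd₂ _ (h' i (not_lt.1 hi))
  · exact Nat.zero_le _

theorem sum_pow_le_card_closedNeighbors
    (hG : G.IsBipartiteWith (V₁ : Set (Fin N)) (V₂ : Set (Fin N)))
    {d₁ : ℕ} (hd₁ : ∀ x ∈ V₁, G.degree x = d₁) {x : Fin n → Fin N}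
    {j : ℕ} (hj : j ≤ n) (h : PostfixIn V₁ x (n - j)) :
    ∑ l ∈ Finset.range (j + 1), d₁ ^ l ≤ (closedNeighbors G V₁ V₂ x).card := by
  rw [card_closedNeighbors hG]
  calc _ = ∑ l ∈ Finset.range (j + 1), levelCount G V₁ V₂ x l := by
        refine Finset.sum_congr rfl fun l hl => ?_
        rw [Finset.mem_range] at hl
        rw [levelCount_of_postfixIn hd₁ (by omega) (h.mono (by omega))]
    _ ≤ _ := Finset.sum_le_sum_of_subset (by simpa using hj)

/-- A last letter in `V₁` excludes nonempty postfixes of type 2, so only levels of type 1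
contribute. -/
theorem card_closedNeighbors_le_of_last_mem
    (hG : G.IsBipartiteWith (V₁ : Set (Fin N)) (V₂ : Set (Fin N)))
    {d₁ : ℕ} (hd₁ : ∀ x ∈ V₁, G.degree x = d₁) {x : Fin n → Fin N}
    {j : ℕ} (hj : j ≤ n) (hlast : PostfixIn V₁ x (n - 1))
    (h : ∀ l, j < l → l ≤ n → ¬ PostfixIn V₁ x (n - l)) :
    (closedNeighbors G V₁ V₂ x).card ≤ ∑ l ∈ Finset.range (j + 1), d₁ ^ l := by
  rw [card_closedNeighbors hG,
    ← Finset.sum_subset (s₁ := Finset.range (j + 1)) (by simpa using hj)]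
  · refine Finset.sum_le_sum fun l hl => ?_
    rw [Finset.mem_range] at hl
    by_cases h1 : PostfixIn V₁ x (n - l)
    · exact (levelCount_of_postfixIn hd₁ (by omega) h1).le
    · rw [levelCount, if_neg]
      · exact Nat.zero_le _
      · rintro (h2 | h2)
        · exact h1 h2
        · have hl1 : l ≠ 0 := by
            -- The empty postfix has both types, so `l = 0` belongs to the previous case.
            rintro rfl
            exact h1 fun i hi => absurd i.2 (by omega)
          have hn : n - 1 < n := by omega
          exact Set.disjoint_left.1 hG.disjoint (hlast ⟨n - 1, hn⟩ le_rfl)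
            (h2 ⟨n - 1, hn⟩ (by simp; omega))
  · intro l hl hl'
    simp only [Finset.mem_range] at hl hl'
    rw [levelCount, if_neg]
    rintro (h2 | h2)
    · exact h l (by omega) (by omega) h2
    · have hn : n - 1 < n := by omega
      exact Set.disjoint_left.1 hG.disjoint (hlast ⟨n - 1, hn⟩ le_rfl)
        (h2 ⟨n - 1, hn⟩ (by simp; omega))

/-- No nonempty postfix has type 1, so every changed letter has at most `d₂` choices; `l = 0`
contributes the word itself. -/
theorem card_closedNeighbors_le_of_last_notMem
    (hG : G.IsBipartiteWith (V₁ : Set (Fin N)) (V₂ : Set (Fin N)))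
    {d₂ : ℕ} (hd₂ : ∀ x ∈ V₂, G.degree x ≤ d₂) {x : Fin n → Fin N}
    (hlast : ¬ PostfixIn V₁ x (n - 1)) :
    (closedNeighbors G V₁ V₂ x).card ≤ ∑ l ∈ Finset.range (n + 1), d₂ ^ l := by
  rw [card_closedNeighbors hG]
  refine Finset.sum_le_sum fun l hl => ?_
  rw [Finset.mem_range] at hl
  rcases Nat.eq_zero_or_pos l with rfl | hl0
  · rw [levelCount]
    split_ifs <;> simp
  · exact levelCount_le_of_not_postfixIn hd₂ (by omega) fun h => hlast (h.mono (by omega))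

open Classical in
theorem card_postfixIn (S : Finset (Fin N)) {j : ℕ} (hj : j ≤ n) :
    (Finset.univ.filter fun x : Fin n → Fin N => PostfixIn S x (n - j)).card
      = N ^ (n - j) * S.card ^ j := by
  have : (Finset.univ.filter fun x : Fin n → Fin N => PostfixIn S x (n - j))
      = Fintype.piFinset fun i : Fin n => if i.val < n - j then Finset.univ else S := by
    ext x
    rw [Fintype.mem_piFinset, Finset.mem_filter_univ, PostfixIn]
    refine forall_congr' fun i => ?_
    split_ifs with h
    · simp; omega
    · simp; omega
  rw [this, Fintype.card_piFinset, ← prod_fin_ite_lt hj]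
  refine Finset.prod_congr rfl fun i _ => ?_
  split_ifs <;> simp

end Combinatorics

/-! ### `N`-adic cells and the mixture formula for the degree. -/

section Intervals

variable {N n : ℕ}

/-- The number with base-`N` digits `x`, the first letter being the leading digit. -/
def wordCode (x : Fin n → Fin N) : ℕ := finFunctionFinEquiv fun i => x i.rev

theorem wordCode_lt (x : Fin n → Fin N) : wordCode x < N ^ n := Fin.is_lt _

theorem wordCode_injective : Function.Injective (wordCode : (Fin n → Fin N) → ℕ) := by
  intro x y h
  have h1 := finFunctionFinEquiv.injective (Fin.ext h)
  funext i
  have := congrFun h1 i.rev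
  simpa using this

theorem sum_div_pow_eq_wordCode [NeZero N] (x : Fin n → Fin N) :
    ∑ i : Fin n, ((x i).val : ℝ) / (N : ℝ) ^ (i.val + 1) = wordCode x / (N : ℝ) ^ n := by
  have hN : (N : ℝ) ≠ 0 := Nat.cast_ne_zero.2 (NeZero.ne N)
  rw [wordCode, finFunctionFinEquiv_apply]
  push_cast
  rw [← Equiv.sum_comp Fin.revPerm, Finset.sum_div]
  refine Finset.sum_congr rfl fun i _ => ?_
  rw [div_eq_div_iff (by positivity) (by positivity), Fin.revPerm_apply, mul_assoc, ← pow_add]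
  congr 2
  have := i.2
  rw [Fin.val_rev]
  omega

/-- The interior of the `N`-adic interval of the word `x`. -/
def adicInterior (x : Fin n → Fin N) : Set ℝ :=
  Set.Ioo (wordCode x / (N : ℝ) ^ n) ((wordCode x + 1) / (N : ℝ) ^ n)

theorem measurableSet_adicInterior (x : Fin n → Fin N) : MeasurableSet (adicInterior x) :=
  measurableSet_Ioo

variable [NeZero N]

theorem adicInterval_eq (x : Fin n → Fin N) :
    adicInterval x = Set.Icc (wordCode x / (N : ℝ) ^ n) ((wordCode x + 1) / (N : ℝ) ^ n) := by
  rw [adicInterval, sum_div_pow_eq_wordCode, ← add_div]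

theorem pow_pos_real : 0 < (N : ℝ) ^ n :=
  pow_pos (Nat.cast_pos.2 (NeZero.pos N)) n

theorem adicInterior_subset (x : Fin n → Fin N) : adicInterior x ⊆ adicInterval x := by
  rw [adicInterval_eq]
  exact Set.Ioo_subset_Icc_self

/-- The integer codes differ by less than 1. Only one membership has to be interior, so the closed
cells that define `Λ_n` can be compared with open ones. -/
theorem eq_of_mem_adicInterior {x y : Fin n → Fin N} {z : ℝ} (hx : z ∈ adicInterior x)
    (hy : z ∈ adicInterval y) : x = y := by
  have hN : 0 < (N : ℝ) ^ n := pow_pos_real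
  rw [adicInterval_eq] at hy
  obtain ⟨h1, h2⟩ := hx
  obtain ⟨h3, h4⟩ := hy
  have h5 := h1.trans_le h4
  have h6 := h3.trans_lt h2
  rw [div_lt_div_iff_of_pos_right hN] at h5 h6
  refine wordCode_injective ?_
  have h5' : wordCode x < wordCode y + 1 := by exact_mod_cast h5
  have h6' : wordCode y < wordCode x + 1 := by exact_mod_cast h6
  omega

theorem adicInterval_subset_unit (x : Fin n → Fin N) : adicInterval x ⊆ Set.Icc 0 1 := by
  have hN : 0 < (N : ℝ) ^ n := pow_pos_real
  rw [adicInterval_eq]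
  refine Set.Icc_subset_Icc (by positivity) ?_
  rw [div_le_one hN]
  exact_mod_cast wordCode_lt x

/-- The uniform distribution on the unit interval. -/
noncomputable abbrev unitUniform : Measure ℝ := volume.restrict (Set.Icc (0 : ℝ) 1)

instance : IsProbabilityMeasure unitUniform := ⟨by simp⟩

theorem unitUniform_adicInterval (x : Fin n → Fin N) :
    unitUniform.real (adicInterval x) = 1 / (N : ℝ) ^ n := by
  have hN : 0 < (N : ℝ) ^ n := pow_pos_real
  rw [measureReal_restrict_apply (by rw [adicInterval_eq]; exact measurableSet_Icc),
    Set.inter_eq_left.2 (adicInterval_subset_unit x), adicInterval_eq, Real.volume_real_Icc_of_le]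
  · ring
  · gcongr; linarith

theorem unitUniform_adicInterior (x : Fin n → Fin N) :
    unitUniform.real (adicInterior x) = 1 / (N : ℝ) ^ n := by
  have hN : 0 < (N : ℝ) ^ n := pow_pos_real
  rw [measureReal_restrict_apply (measurableSet_adicInterior x),
    Set.inter_eq_left.2 ((adicInterior_subset x).trans (adicInterval_subset_unit x)),
    adicInterior, Real.volume_real_Ioo_of_le]
  · ring
  · gcongr; linarith

theorem pairwiseDisjoint_adicInterior (s : Set (Fin n → Fin N)) :
    s.PairwiseDisjoint adicInterior := by
  intro x _ y _ hne
  rw [Function.onFun, Set.disjoint_left]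
  exact fun z hx hy => hne (eq_of_mem_adicInterior hx (adicInterior_subset y hy))

theorem unitUniform_biUnion_adicInterior (s : Finset (Fin n → Fin N)) :
    unitUniform.real (⋃ x ∈ s, adicInterior x) = s.card / (N : ℝ) ^ n := by
  rw [measureReal_biUnion_finset (pairwiseDisjoint_adicInterior _)
    (fun x _ => measurableSet_adicInterior x),
    Finset.sum_congr rfl fun x _ => unitUniform_adicInterior x]
  simp [div_eq_mul_inv]

/-- Closed cells may share endpoints: subadditivity bounds from above, the disjoint interiors from
below. -/
theorem unitUniform_biUnion_adicInterval (s : Finset (Fin n → Fin N)) :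
    unitUniform.real (⋃ x ∈ s, adicInterval x) = s.card / (N : ℝ) ^ n := by
  refine le_antisymm ?_ ?_
  · refine (measureReal_biUnion_finset_le _ _).trans ?_
    rw [Finset.sum_congr rfl fun x _ => unitUniform_adicInterval x]
    simp [div_eq_mul_inv]
  · rw [← unitUniform_biUnion_adicInterior]
    exact measureReal_mono (Set.iUnion₂_mono fun x _ => adicInterior_subset x)
      (measure_ne_top _ _)

theorem ae_exists_mem_adicInterior :
    ∀ᵐ z ∂unitUniform, ∃ x : Fin n → Fin N, z ∈ adicInterior x := by
  have hN : 0 < (N : ℝ) ^ n := pow_pos_real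
  have h := unitUniform_biUnion_adicInterior (Finset.univ : Finset (Fin n → Fin N))
  rw [Finset.card_univ, Fintype.card_fun, Fintype.card_fin, Fintype.card_fin] at h
  push_cast at h
  rw [div_self hN.ne'] at h
  have h2 : unitUniform (⋃ x ∈ (Finset.univ : Finset (Fin n → Fin N)), adicInterior x) = 1 := by
    rw [← ofReal_measureReal (measure_ne_top _ _), h, ENNReal.ofReal_one]
  have h3 := (prob_compl_eq_zero_iff
    (Finset.measurableSet_biUnion _ fun x _ => measurableSet_adicInterior x)).2 h2
  rw [ae_iff]
  convert! h3 using 2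
  ext z
  simp

/-- The section of `Λ_n` over the interior of the `N`-adic interval of the word `x`. -/
def adjacencySection (G : SimpleGraph (Fin N)) (V₁ V₂ : Finset (Fin N)) (x : Fin n → Fin N) :
    Set ℝ :=
  ⋃ y ∈ closedNeighbors G V₁ V₂ x, adicInterval y

theorem measurableSet_adjacencySection (G : SimpleGraph (Fin N)) (V₁ V₂ : Finset (Fin N))
    (x : Fin n → Fin N) : MeasurableSet (adjacencySection G V₁ V₂ x) :=
  Finset.measurableSet_biUnion _ fun y _ => by rw [adicInterval_eq]; exact measurableSet_Icc

theorem mem_embeddedAdjacency_iff {G : SimpleGraph (Fin N)} {V₁ V₂ : Finset (Fin N)}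
    {x : Fin n → Fin N} {a b : ℝ} (ha : a ∈ adicInterior x) :
    (a, b) ∈ embeddedAdjacency G V₁ V₂ n ↔ b ∈ adjacencySection G V₁ V₂ x := by
  simp only [adjacencySection, Set.mem_iUnion₂, mem_closedNeighbors]
  constructor
  · rintro ⟨x', y, he, hx', hy⟩
    rw [← eq_of_mem_adicInterior ha hx'] at he
    exact ⟨y, he, hy⟩
  · rintro ⟨y, he, hy⟩
    exact ⟨x, y, he, adicInterior_subset x ha, hy⟩

/-- Over the interior of a cell the section of `Λ_n` is constant, so the degree counts the other
points in a fixed set. -/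
theorem pointDegree_eq_hits {G : SimpleGraph (Fin N)} {V₁ V₂ : Finset (Fin N)}
    {Ω ι : Type*} [Fintype ι] [DecidableEq ι] (X : ι → Ω → ℝ) (ω : Ω) (v : ι)
    {x : Fin n → Fin N} (hv : X v ω ∈ adicInterior x) :
    (pointDegree G V₁ V₂ n (fun i => X i ω) v : ℝ)
      = hits (Finset.univ.erase v) X (adjacencySection G V₁ V₂ x) ω := by
  classical
  have h : (pointGraph G V₁ V₂ n fun i => X i ω).neighborSet v
      = ((Finset.univ.erase v).filter fun i => X i ω ∈ adjacencySection G V₁ V₂ x : Finset ι) := by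
    ext j
    simp [pointGraph, mem_embeddedAdjacency_iff hv, eq_comm]
  rw [pointDegree, h, Set.ncard_coe_finset, hits, Finset.card_filter]
  push_cast
  refine Finset.sum_congr rfl fun i _ => ?_
  simp [Set.indicator_apply]

/-- The tail of the degree of a random vertex, as a mixture of binomial tails over the words. -/
theorem degree_tail_eq {G : SimpleGraph (Fin N)} {V₁ V₂ : Finset (Fin N)} {m : ℕ}
    {Ω : Type*} [MeasurableSpace Ω] {P : Measure Ω} [IsProbabilityMeasure P]
    {X : Fin (m + 1) → Ω → ℝ} (hX : ∀ i, Measurable (X i))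
    (hlaw : ∀ i, P.map (X i) = unitUniform) (hind : iIndepFun X P)
    {V : Ω → Fin (m + 1)} (hV : Measurable V) (hVlaw : P.map V = uniformOn Set.univ)
    (hVX : IndepFun V (fun ω i => X i ω) P) (u : ℝ) :
    P.real {ω | u < (pointDegree G V₁ V₂ n (fun i => X i ω) (V ω) : ℝ)}
      = ∑ v : Fin (m + 1), 1 / ((m : ℝ) + 1) * ∑ x : Fin n → Fin N, 1 / (N : ℝ) ^ n *
        P.real {ω | u < hits (Finset.univ.erase v) X (adjacencySection G V₁ V₂ x) ω} := by
  classical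
  let F : Fin (m + 1) → (Fin n → Fin N) → Set Ω := fun v x =>
    X v ⁻¹' adicInterior x ∩
      {ω | u < hits (Finset.univ.erase v) X (adjacencySection G V₁ V₂ x) ω}
  have hmeasH : ∀ v (x : Fin n → Fin N), MeasurableSet
      {ω | u < hits (Finset.univ.erase v) X (adjacencySection G V₁ V₂ x) ω} := fun v x =>
    measurableSet_lt measurable_const
      (measurable_hits hX (measurableSet_adjacencySection G V₁ V₂ x))
  have hae : ∀ᵐ ω ∂P, ∀ v, ∃ x : Fin n → Fin N, X v ω ∈ adicInterior x := by
    rw [ae_all_iff]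
    intro v
    have h := ae_exists_mem_adicInterior (N := N) (n := n)
    rw [← hlaw v] at h
    exact ae_of_ae_map (hX v).aemeasurable h
  have hunion : P.real {ω | u < (pointDegree G V₁ V₂ n (fun i => X i ω) (V ω) : ℝ)}
      = P.real (⋃ q ∈ (Finset.univ : Finset (Fin (m + 1) × (Fin n → Fin N))),
        V ⁻¹' {q.1} ∩ F q.1 q.2) := by
    refine measureReal_congr (eventuallyEq_set.2 ?_)
    filter_upwards [hae] with ω hω
    obtain ⟨x, hx⟩ := hω (V ω)
    rw [pointDegree_eq_hits X ω (V ω) hx]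
    simp only [Set.mem_iUnion, Finset.mem_univ, exists_const, Set.mem_inter_iff, Set.mem_preimage,
      Set.mem_singleton_iff, Prod.exists, F, Set.mem_ofPred_eq]
    constructor
    · intro h
      exact ⟨V ω, x, rfl, hx, h⟩
    · rintro ⟨v, y, rfl, hy, h⟩
      rwa [eq_of_mem_adicInterior hx (adicInterior_subset y hy)]
  -- The point of `v` is independent of the family of all other points, which alone determines the
  -- hits.
  have hF : ∀ v x, P.real (F v x) = 1 / (N : ℝ) ^ n *
      P.real {ω | u < hits (Finset.univ.erase v) X (adjacencySection G V₁ V₂ x) ω} := by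
    intro v x
    have hi := hind.indepFun_finset {v} (Finset.univ.erase v) (by simp) hX
    let A : Set (({v} : Finset (Fin (m + 1))) → ℝ) :=
      (fun y => y ⟨v, Finset.mem_singleton_self v⟩) ⁻¹' adicInterior x
    let B : Set (↥(Finset.univ.erase v) → ℝ) :=
      {y | u < ∑ i, (adjacencySection G V₁ V₂ x).indicator 1 (y i)}
    have hA : MeasurableSet A := (measurable_pi_apply _) (measurableSet_adicInterior x)
    have hB : MeasurableSet B := by
      refine measurableSet_lt measurable_const (Finset.measurable_sum _ fun i _ => ?_)
      exact (measurable_hit (measurableSet_adjacencySection G V₁ V₂ x)).comp (measurable_pi_apply i)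
    have h := hi.measure_inter_preimage_eq_mul A B hA hB
    have hB' : (fun ω (i : (Finset.univ.erase v : Finset (Fin (m + 1)))) => X i ω) ⁻¹' B
        = {ω | u < hits (Finset.univ.erase v) X (adjacencySection G V₁ V₂ x) ω} := by
      ext ω
      simp only [B, hits, Set.mem_preimage, Set.mem_ofPred_eq]
      rw [Finset.sum_coe_sort (Finset.univ.erase v)
        fun i => (adjacencySection G V₁ V₂ x).indicator (1 : ℝ → ℝ) (X i ω)]
    rw [hB'] at h
    have h' := congrArg ENNReal.toReal h
    rw [ENNReal.toReal_mul] at h'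
    have hx : P.real (X v ⁻¹' adicInterior x) = 1 / (N : ℝ) ^ n := by
      rw [← map_measureReal_apply (hX v) (measurableSet_adicInterior x), hlaw,
        unitUniform_adicInterior]
    rw [← hx]
    exact h'
  have hFm : ∀ v x, MeasurableSet (F v x) := fun v x =>
    ((hX v) (measurableSet_adicInterior x)).inter (hmeasH v x)
  have hVF : ∀ v x, P.real (V ⁻¹' {v} ∩ F v x) = 1 / ((m : ℝ) + 1) * P.real (F v x) := by
    intro v x
    let B : Set (Fin (m + 1) → ℝ) := (fun y => y v) ⁻¹' adicInterior x ∩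
      {y | u < ∑ i ∈ Finset.univ.erase v, (adjacencySection G V₁ V₂ x).indicator 1 (y i)}
    have hB : MeasurableSet B := by
      refine MeasurableSet.inter ((measurable_pi_apply v) (measurableSet_adicInterior x)) ?_
      refine measurableSet_lt measurable_const (Finset.measurable_sum _ fun i _ => ?_)
      exact (measurable_hit (measurableSet_adjacencySection G V₁ V₂ x)).comp (measurable_pi_apply i)
    have h := hVX.measure_inter_preimage_eq_mul {v} B (measurableSet_singleton v) hB
    have h' := congrArg ENNReal.toReal h
    rw [ENNReal.toReal_mul] at h'
    have hv : P.real (V ⁻¹' {v}) = 1 / ((m : ℝ) + 1) := by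
      rw [← map_measureReal_apply hV (measurableSet_singleton v), hVlaw, measureReal_def,
        uniformOn_univ]
      simp [ENNReal.toReal_add]
    rw [← hv]
    exact h'
  rw [hunion, measureReal_biUnion_finset]
  · rw [← Finset.univ_product_univ, Finset.sum_product]
    refine Finset.sum_congr rfl fun v _ => ?_
    rw [Finset.mul_sum]
    exact Finset.sum_congr rfl fun x _ => by rw [hVF, hF]
  · rintro ⟨v, x⟩ _ ⟨v', x'⟩ _ hne
    rw [Function.onFun, Set.disjoint_left]
    rintro ω ⟨h1, h2, _⟩ ⟨h3, h4, _⟩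
    have h5 : v = v' := Eq.trans (Eq.symm h1) h3
    subst h5
    exact hne (Prod.ext rfl (eq_of_mem_adicInterior h2 (adicInterior_subset _ h4)))
  · intro q _
    exact (hV (measurableSet_singleton _)).inter (hFm _ _)

end Intervals

/-! ### From words to the degree tail. -/

section TailBounds

variable {Ω : Type*} [MeasurableSpace Ω]

/-- The points `X i` are independent and uniform on the unit interval, and `V` is a uniform index
independent of them. -/
structure IsUniformSample (P : Measure Ω) {m : ℕ} (X : Fin (m + 1) → Ω → ℝ)
    (V : Ω → Fin (m + 1)) : Prop where
  measurable_point : ∀ i, Measurable (X i)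
  law_point : ∀ i, P.map (X i) = unitUniform
  indep_point : iIndepFun X P
  measurable_vertex : Measurable V
  law_vertex : P.map V = uniformOn Set.univ
  indep_vertex : IndepFun V (fun ω i => X i ω) P

/-- The tail `P(deg V > u)` of the degree of the random vertex `V`. -/
noncomputable def degreeTail {N : ℕ} (G : SimpleGraph (Fin N)) (V₁ V₂ : Finset (Fin N)) (n : ℕ)
    (P : Measure Ω) {m : ℕ} (X : Fin (m + 1) → Ω → ℝ) (V : Ω → Fin (m + 1)) (u : ℝ) : ℝ :=
  P.real {ω | u < (pointDegree G V₁ V₂ n (fun i => X i ω) (V ω) : ℝ)}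

/-- The tail of the degree of the vertex `v` when the point `X v` lies in the interval of `x`. -/
noncomputable def wordTail {N n : ℕ} (G : SimpleGraph (Fin N)) (V₁ V₂ : Finset (Fin N))
    (P : Measure Ω) {m : ℕ} (X : Fin (m + 1) → Ω → ℝ) (v : Fin (m + 1)) (x : Fin n → Fin N)
    (u : ℝ) : ℝ :=
  P.real {ω | u < hits (Finset.univ.erase v) X (adjacencySection G V₁ V₂ x) ω}

variable {N n m : ℕ} [NeZero N] {G : SimpleGraph (Fin N)} {V₁ V₂ : Finset (Fin N)}
  {P : Measure Ω} [IsProbabilityMeasure P] {X : Fin (m + 1) → Ω → ℝ} {V : Ω → Fin (m + 1)}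

theorem IsUniformSample.degreeTail_eq (h : IsUniformSample P X V) (u : ℝ) :
    degreeTail G V₁ V₂ n P X V u = ∑ v : Fin (m + 1), 1 / ((m : ℝ) + 1) *
      ∑ x : Fin n → Fin N, 1 / (N : ℝ) ^ n * wordTail G V₁ V₂ P X v x u :=
  degree_tail_eq h.measurable_point h.law_point h.indep_point h.measurable_vertex h.law_vertex
    h.indep_vertex u

theorem sum_const_inv_succ (b : ℝ) : ∑ _v : Fin (m + 1), 1 / ((m : ℝ) + 1) * b = b := by
  rw [Finset.sum_const, Finset.card_univ, Fintype.card_fin, nsmul_eq_mul]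
  push_cast
  field_simp

theorem sum_postfixIn_div {j : ℕ} (hj : j ≤ n) [DecidablePred fun x : Fin n → Fin N =>
    PostfixIn V₁ x (n - j)] :
    ∑ x : Fin n → Fin N, 1 / (N : ℝ) ^ n * (if PostfixIn V₁ x (n - j) then 1 else 0)
      = ((V₁.card : ℝ) / N) ^ j := by
  have hN : (N : ℝ) ≠ 0 := Nat.cast_ne_zero.2 (NeZero.ne N)
  rw [← Finset.mul_sum, ← Finset.sum_filter, Finset.sum_const, nsmul_eq_mul, mul_one]
  have h := card_postfixIn (N := N) V₁ hj
  have h' : ((Finset.univ.filter fun x : Fin n → Fin N => PostfixIn V₁ x (n - j)).card : ℝ)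
      = (N : ℝ) ^ (n - j) * (V₁.card : ℝ) ^ j := by
    rw [← Nat.cast_pow, ← Nat.cast_pow, ← Nat.cast_mul, ← h]
    congr!
  rw [h', div_pow]
  have hp : (N : ℝ) ^ n = (N : ℝ) ^ (n - j) * (N : ℝ) ^ j := by rw [← pow_add]; congr 1; omega
  rw [hp]
  field_simp

theorem IsUniformSample.le_degreeTail (h : IsUniformSample P X V) {j : ℕ} (hj : j ≤ n) {u q : ℝ}
    (hq : ∀ v (x : Fin n → Fin N), PostfixIn V₁ x (n - j) → q ≤ wordTail G V₁ V₂ P X v x u) :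
    ((V₁.card : ℝ) / N) ^ j * q ≤ degreeTail G V₁ V₂ n P X V u := by
  classical
  rw [h.degreeTail_eq, ← sum_const_inv_succ (m := m) (((V₁.card : ℝ) / N) ^ j * q)]
  refine Finset.sum_le_sum fun v _ => mul_le_mul_of_nonneg_left ?_ (by positivity)
  rw [← sum_postfixIn_div hj, Finset.sum_mul]
  refine Finset.sum_le_sum fun x _ => ?_
  rw [mul_assoc]
  refine mul_le_mul_of_nonneg_left ?_ (by positivity)
  split_ifs with hx
  · rw [one_mul]; exact hq v x hx
  · rw [zero_mul]; exact measureReal_nonneg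

/-- Deeper words cost 1, words of level exactly `j` cost `q`, the rest cost `τ`. Since the masses of
depth at least `j` and `j + 1` are nested, the excess `1 - q` is charged to the deeper ones only. -/
theorem IsUniformSample.degreeTail_le (h : IsUniformSample P X V) {j : ℕ} (hj : j ≤ n) {u q τ : ℝ}
    (hq1 : q ≤ 1) (hτ : 0 ≤ τ)
    (hmid : ∀ v (x : Fin n → Fin N), PostfixIn V₁ x (n - j) →
      (∀ l, j < l → l ≤ n → ¬ PostfixIn V₁ x (n - l)) → wordTail G V₁ V₂ P X v x u ≤ q)
    (hlow : ∀ v (x : Fin n → Fin N), ¬ PostfixIn V₁ x (n - j) →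
      wordTail G V₁ V₂ P X v x u ≤ τ) :
    degreeTail G V₁ V₂ n P X V u ≤
      ((V₁.card : ℝ) / N) ^ j * q + ((V₁.card : ℝ) / N) ^ (j + 1) * (1 - q) + τ := by
  classical
  have hN : (N : ℝ) ≠ 0 := Nat.cast_ne_zero.2 (NeZero.ne N)
  set B := ((V₁.card : ℝ) / N) ^ j * q + ((V₁.card : ℝ) / N) ^ (j + 1) * (1 - q) + τ with hB
  rw [h.degreeTail_eq, ← sum_const_inv_succ (m := m) B]
  refine Finset.sum_le_sum fun v _ => mul_le_mul_of_nonneg_left ?_ (by positivity)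
  have hone : ∑ _x : Fin n → Fin N, 1 / (N : ℝ) ^ n * τ = τ := by
    rw [Finset.sum_const, Finset.card_univ, Fintype.card_fun, Fintype.card_fin, Fintype.card_fin,
      nsmul_eq_mul]
    push_cast
    field_simp
  have htop : ∑ x : Fin n → Fin N, 1 / (N : ℝ) ^ n *
      (if ∃ l, j < l ∧ l ≤ n ∧ PostfixIn V₁ x (n - l) then 1 else 0)
      ≤ ((V₁.card : ℝ) / N) ^ (j + 1) := by
    -- For `j = n` there are no deeper words and the sum vanishes.
    rcases hj.eq_or_lt with rfl | hlt
    · rw [Finset.sum_eq_zero]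
      · positivity
      · intro x _
        rw [if_neg, mul_zero]
        rintro ⟨l, h1, h2, -⟩
        omega
    · rw [← sum_postfixIn_div (n := n) (j := j + 1) hlt]
      refine Finset.sum_le_sum fun x _ => mul_le_mul_of_nonneg_left ?_ (by positivity)
      split_ifs with h1 h2 h3
      · exact le_rfl
      · obtain ⟨l, h3, _, h4⟩ := h1
        exact absurd (h4.mono (by omega)) h2
      · exact zero_le_one
      · exact le_rfl
  have hpt : ∀ x : Fin n → Fin N, wordTail G V₁ V₂ P X v x u ≤
      (if PostfixIn V₁ x (n - j) then 1 else 0) * q +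
      (if ∃ l, j < l ∧ l ≤ n ∧ PostfixIn V₁ x (n - l) then 1 else 0) * (1 - q) + τ := by
    intro x
    have hle1 : wordTail G V₁ V₂ P X v x u ≤ 1 := measureReal_le_one
    by_cases h2 : ∃ l, j < l ∧ l ≤ n ∧ PostfixIn V₁ x (n - l)
    · have h1 : PostfixIn V₁ x (n - j) := by
        obtain ⟨l, h3, _, h4⟩ := h2
        exact h4.mono (by omega)
      rw [if_pos h1, if_pos h2]
      linarith
    · rw [if_neg h2]
      by_cases h1 : PostfixIn V₁ x (n - j)
      · rw [if_pos h1]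
        push Not at h2
        linarith [hmid v x h1 h2]
      · rw [if_neg h1]
        linarith [hlow v x h1]
  calc ∑ x : Fin n → Fin N, 1 / (N : ℝ) ^ n * wordTail G V₁ V₂ P X v x u
      ≤ ∑ x : Fin n → Fin N, 1 / (N : ℝ) ^ n * ((if PostfixIn V₁ x (n - j) then 1 else 0) * q +
      (if ∃ l, j < l ∧ l ≤ n ∧ PostfixIn V₁ x (n - l) then 1 else 0) * (1 - q) + τ) :=
        Finset.sum_le_sum fun x _ => mul_le_mul_of_nonneg_left (hpt x) (by positivity)
    _ = (∑ x : Fin n → Fin N, 1 / (N : ℝ) ^ n * (if PostfixIn V₁ x (n - j) then 1 else 0)) * q +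
      (∑ x : Fin n → Fin N, 1 / (N : ℝ) ^ n *
        (if ∃ l, j < l ∧ l ≤ n ∧ PostfixIn V₁ x (n - l) then 1 else 0)) * (1 - q) +
      ∑ _x : Fin n → Fin N, 1 / (N : ℝ) ^ n * τ := by
        rw [Finset.sum_mul, Finset.sum_mul, ← Finset.sum_add_distrib, ← Finset.sum_add_distrib]
        exact Finset.sum_congr rfl fun x _ => by ring
    _ ≤ B := by
        rw [sum_postfixIn_div hj, hone, hB]
        have := mul_le_mul_of_nonneg_right htop (by linarith : 0 ≤ 1 - q)
        linarith

omit [IsProbabilityMeasure P] in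
theorem IsUniformSample.real_preimage_adjacencySection (h : IsUniformSample P X V)
    (x : Fin n → Fin N) (i : Fin (m + 1)) :
    P.real (X i ⁻¹' adjacencySection G V₁ V₂ x)
      = (closedNeighbors G V₁ V₂ x).card / (N : ℝ) ^ n := by
  rw [← map_measureReal_apply (h.measurable_point i) (measurableSet_adjacencySection G V₁ V₂ x),
    h.law_point, adjacencySection, unitUniform_biUnion_adicInterval]

theorem card_closedNeighbors_div_le_one (x : Fin n → Fin N) :
    ((closedNeighbors G V₁ V₂ x).card : ℝ) / (N : ℝ) ^ n ≤ 1 := by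
  rw [div_le_one pow_pos_real]
  have := Finset.card_le_univ (closedNeighbors G V₁ V₂ x)
  rw [Fintype.card_fun, Fintype.card_fin, Fintype.card_fin] at this
  exact_mod_cast this

/-- Without the loop exactly `m` of the `m + 1` points remain, so the binomial mean is exactly `c
d`. -/
theorem card_erase_mul_div {c : ℝ} (hm : (m : ℝ) = c * (N : ℝ) ^ n) (v : Fin (m + 1)) (d : ℝ) :
    ((Finset.univ.erase v).card : ℝ) * (d / (N : ℝ) ^ n) = c * d := by
  have hN : 0 < (N : ℝ) ^ n := pow_pos_real
  rw [Finset.card_erase_of_mem (Finset.mem_univ v), Finset.card_univ, Fintype.card_fin,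
    Nat.add_sub_cancel, hm]
  field_simp

theorem IsUniformSample.wordTail_le_exp (h : IsUniformSample P X V) {c : ℝ} (hc : 0 ≤ c)
    (hm : (m : ℝ) = c * (N : ℝ) ^ n) {x : Fin n → Fin N} {D η u : ℝ}
    (hD : ((closedNeighbors G V₁ V₂ x).card : ℝ) ≤ D) (hη0 : 0 ≤ η) (hη1 : η ≤ 1)
    (hu : (1 + η) * (c * D) ≤ u) (v : Fin (m + 1)) :
    wordTail G V₁ V₂ P X v x u ≤ Real.exp (-(η ^ 2 / 4 * (c * D))) := by
  refine le_trans (measureReal_mono fun ω hω => ?_)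
    (hits_upper_tail (s := Finset.univ.erase v) h.measurable_point
      (measurableSet_adjacencySection G V₁ V₂ x) h.indep_point
      (h.real_preimage_adjacencySection x) (by positivity)
      (card_closedNeighbors_div_le_one x) ?_ hη0 hη1)
  · exact hu.trans (le_of_lt hω)
  · rw [card_erase_mul_div hm]
    gcongr

theorem IsUniformSample.one_sub_exp_le_wordTail (h : IsUniformSample P X V) {c : ℝ} (hc : 0 ≤ c)
    (hm : (m : ℝ) = c * (N : ℝ) ^ n) {x : Fin n → Fin N} {D η u : ℝ}
    (hD : D ≤ ((closedNeighbors G V₁ V₂ x).card : ℝ)) (hη0 : 0 ≤ η) (hη1 : η ≤ 1)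
    (hu : u ≤ (1 - η) * (c * D)) (v : Fin (m + 1)) :
    1 - Real.exp (-(η ^ 2 / 4 * (c * D))) ≤ wordTail G V₁ V₂ P X v x u := by
  have hmeas : MeasurableSet {ω | u < hits (Finset.univ.erase v) X
      (adjacencySection G V₁ V₂ x) ω} :=
    measurableSet_lt measurable_const
      (measurable_hits h.measurable_point (measurableSet_adjacencySection G V₁ V₂ x))
  have h1 := probReal_compl_eq_one_sub (μ := P) hmeas
  have h2 : P.real {ω | u < hits (Finset.univ.erase v) X (adjacencySection G V₁ V₂ x) ω}ᶜ
      ≤ Real.exp (-(η ^ 2 / 4 * (c * D))) := by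
    refine le_trans (measureReal_mono fun ω hω => ?_)
      (hits_lower_tail (s := Finset.univ.erase v) h.measurable_point
        (measurableSet_adjacencySection G V₁ V₂ x) h.indep_point
        (h.real_preimage_adjacencySection x) (by positivity)
        (card_closedNeighbors_div_le_one x) ?_ hη0 hη1)
    · rw [Set.mem_compl_iff, Set.mem_ofPred_eq, not_lt] at hω
      exact hω.trans hu
    · rw [card_erase_mul_div hm]
      gcongr
  rw [h1] at h2
  change _ ≤ P.real _
  linarith

/-- `t_k` as a geometric sum. -/
theorem levelDegree_eq_sum {d₁ : ℕ} (hd : 2 ≤ d₁) (k : ℕ) :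
    levelDegree d₁ k = ((∑ l ∈ Finset.range (k + 1), d₁ ^ l : ℕ) : ℝ) := by
  have : (d₁ : ℝ) ≠ 1 := by
    have : d₁ ≠ 1 := by omega
    exact_mod_cast this
  push_cast
  rw [geom_sum_eq this, levelDegree]

variable [DecidableRel G.Adj] {d₁ d₂ : ℕ}

theorem IsUniformSample.le_degreeTail_of_le (h : IsUniformSample P X V)
    (hG : G.IsBipartiteWith (V₁ : Set (Fin N)) (V₂ : Set (Fin N)))
    (hd₁ : ∀ x ∈ V₁, G.degree x = d₁) (hd : 2 ≤ d₁) {c : ℝ} (hc : 0 ≤ c)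
    (hm : (m : ℝ) = c * (N : ℝ) ^ n) {j : ℕ} (hj : j ≤ n) {η u : ℝ} (hη0 : 0 ≤ η) (hη1 : η ≤ 1)
    (hu : u ≤ (1 - η) * (c * levelDegree d₁ j)) :
    ((V₁.card : ℝ) / N) ^ j * (1 - Real.exp (-(η ^ 2 / 4 * (c * levelDegree d₁ j))))
      ≤ degreeTail G V₁ V₂ n P X V u := by
  refine h.le_degreeTail hj fun v x hx => ?_
  refine h.one_sub_exp_le_wordTail hc hm ?_ hη0 hη1 hu v
  rw [levelDegree_eq_sum hd]
  exact_mod_cast sum_pow_le_card_closedNeighbors hG hd₁ hj hx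

/-- Words below level `j + 1` have at most `t_j` neighbours if they end in `V₁` and at most `∑ d₂^l`
otherwise. `D` dominates both, and Chernoff at `D` controls them all. -/
theorem IsUniformSample.degreeTail_le_add_exp (h : IsUniformSample P X V)
    (hG : G.IsBipartiteWith (V₁ : Set (Fin N)) (V₂ : Set (Fin N)))
    (hd₁ : ∀ x ∈ V₁, G.degree x = d₁) (hd₂ : ∀ x ∈ V₂, G.degree x ≤ d₂) (hd : 2 ≤ d₁)
    {c : ℝ} (hc : 0 ≤ c) (hm : (m : ℝ) = c * (N : ℝ) ^ n) {j : ℕ} (hj : j + 1 ≤ n) {η u q D : ℝ}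
    (hη0 : 0 ≤ η) (hη1 : η ≤ 1) (hq1 : q ≤ 1)
    (hD₁ : levelDegree d₁ j ≤ D) (hD₂ : ((∑ l ∈ Finset.range (n + 1), d₂ ^ l : ℕ) : ℝ) ≤ D)
    (hu : (1 + η) * (c * D) ≤ u)
    (hmid : ∀ v (x : Fin n → Fin N), PostfixIn V₁ x (n - (j + 1)) →
      (∀ l, j + 1 < l → l ≤ n → ¬ PostfixIn V₁ x (n - l)) → wordTail G V₁ V₂ P X v x u ≤ q) :
    degreeTail G V₁ V₂ n P X V u ≤ ((V₁.card : ℝ) / N) ^ (j + 1) * q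
      + ((V₁.card : ℝ) / N) ^ (j + 2) * (1 - q) + Real.exp (-(η ^ 2 / 4 * (c * D))) := by
  refine h.degreeTail_le hj hq1 (Real.exp_pos _).le hmid fun v x hx => ?_
  refine h.wordTail_le_exp hc hm ?_ hη0 hη1 hu v
  by_cases hlast : PostfixIn V₁ x (n - 1)
  · refine le_trans ?_ hD₁
    rw [levelDegree_eq_sum hd]
    exact_mod_cast card_closedNeighbors_le_of_last_mem hG hd₁ (by omega) hlast
      fun l h1 h2 h3 => hx (h3.mono (by omega))
  · refine le_trans ?_ hD₂
    exact_mod_cast card_closedNeighbors_le_of_last_notMem hG hd₂ hlast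

-- The upper and lower counts meet; `1 ≤ j` puts the last letter in `V₁`.
omit [NeZero N] in
theorem card_closedNeighbors_eq_levelDegree
    (hG : G.IsBipartiteWith (V₁ : Set (Fin N)) (V₂ : Set (Fin N)))
    (hd₁ : ∀ x ∈ V₁, G.degree x = d₁) (hd : 2 ≤ d₁) {j : ℕ} (hj1 : 1 ≤ j) (hj : j ≤ n)
    {x : Fin n → Fin N} (hx : PostfixIn V₁ x (n - j))
    (hx' : ∀ l, j < l → l ≤ n → ¬ PostfixIn V₁ x (n - l)) :
    ((closedNeighbors G V₁ V₂ x).card : ℝ) = levelDegree d₁ j := by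
  rw [levelDegree_eq_sum hd]
  exact_mod_cast le_antisymm
    (card_closedNeighbors_le_of_last_mem hG hd₁ hj (hx.mono (by omega)) hx')
    (sum_pow_le_card_closedNeighbors hG hd₁ hj hx)

end TailBounds

/-! ### Gaussian estimates close to a level. -/

/-- A binomial variable with large mean and small success probability exceeds its mean with
probability almost one half. -/
theorem exists_forall_le_degreeTail {r : ℝ} (hr : r < 1 / 2) :
    ∃ m₀ p₀ : ℝ, 0 < p₀ ∧ ∀ {Ω : Type*} [MeasurableSpace Ω] {N n m : ℕ} [NeZero N]
      {G : SimpleGraph (Fin N)} {V₁ V₂ : Finset (Fin N)} [DecidableRel G.Adj] {d₁ : ℕ}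
      {P : Measure Ω} [IsProbabilityMeasure P] {X : Fin (m + 1) → Ω → ℝ} {V : Ω → Fin (m + 1)}
      (_ : IsUniformSample P X V)
      (_ : G.IsBipartiteWith (V₁ : Set (Fin N)) (V₂ : Set (Fin N)))
      (_ : ∀ x ∈ V₁, G.degree x = d₁) (_ : 2 ≤ d₁) {c : ℝ}
      (_ : (m : ℝ) = c * (N : ℝ) ^ n) (_ : 1 ≤ n)
      (_ : levelDegree d₁ n / (N : ℝ) ^ n ≤ p₀) (_ : m₀ ≤ c * levelDegree d₁ n) {u : ℝ}
      (_ : u ≤ c * levelDegree d₁ n),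
      ((V₁.card : ℝ) / N) ^ n * r ≤ degreeTail G V₁ V₂ n P X V u := by
  obtain ⟨m₀, p₀, hp₀, H⟩ := exists_forall_lt_hits_open (U := Set.Ioi 0) isOpen_Ioi
    (r := r) (by rwa [gaussianReal_real_Ioi_zero])
  -- The 1 keeps the mean positive, so that one can divide by its square root.
  refine ⟨max m₀ 1, p₀, hp₀, ?_⟩
  intro Ω _ N n m _ G V₁ V₂ _ d₁ P _ X V h hG hd₁ hd c hm hn hp hm₀ u hu
  refine h.le_degreeTail le_rfl fun v x hx => ?_
  have hcard := card_closedNeighbors_eq_levelDegree hG hd₁ hd hn le_rfl hx (by intros; omega)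
  have hmean := card_erase_mul_div hm v (levelDegree d₁ n)
  have hH := H P (Finset.univ.erase v) X (adjacencySection G V₁ V₂ x)
    (levelDegree d₁ n / (N : ℝ) ^ n) h.measurable_point (measurableSet_adjacencySection G V₁ V₂ x)
    h.indep_point (by intro i; rw [h.real_preimage_adjacencySection, hcard])
    (by rw [← hcard]; positivity) hp (by rw [hmean]; exact (le_max_left _ _).trans hm₀)
  rw [hmean] at hH
  refine hH.le.trans (measureReal_mono fun ω hω => ?_)
  have hpos : 0 < √(c * levelDegree d₁ n) :=
    Real.sqrt_pos.2 (zero_lt_one.trans_le ((le_max_right _ _).trans hm₀))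
  have hω' := (div_pos_iff_of_pos_right hpos).1 hω
  change u < _
  linarith

/-- A binomial variable with large mean `μ` and small success probability is at most `μ - K √μ`
with probability bounded below. -/
theorem exists_forall_wordTail_le (K : ℝ) :
    ∃ δ m₀ p₀ : ℝ, 0 < δ ∧ δ ≤ 1 ∧ 0 < p₀ ∧ ∀ {Ω : Type*} [MeasurableSpace Ω] {N n m : ℕ} [NeZero N]
      {G : SimpleGraph (Fin N)} {V₁ V₂ : Finset (Fin N)} [DecidableRel G.Adj] {d₁ : ℕ}
      {P : Measure Ω} [IsProbabilityMeasure P] {X : Fin (m + 1) → Ω → ℝ} {V : Ω → Fin (m + 1)}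
      (_ : IsUniformSample P X V)
      (_ : G.IsBipartiteWith (V₁ : Set (Fin N)) (V₂ : Set (Fin N)))
      (_ : ∀ x ∈ V₁, G.degree x = d₁) (_ : 2 ≤ d₁) {c : ℝ}
      (_ : (m : ℝ) = c * (N : ℝ) ^ n) {j : ℕ} (_ : 1 ≤ j) (_ : j ≤ n)
      (_ : levelDegree d₁ j / (N : ℝ) ^ n ≤ p₀) (_ : m₀ ≤ c * levelDegree d₁ j) {u : ℝ}
      (_ : c * levelDegree d₁ j - K * √(c * levelDegree d₁ j) ≤ u)
      (v : Fin (m + 1)) (x : Fin n → Fin N), PostfixIn V₁ x (n - j) →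
      (∀ l, j < l → l ≤ n → ¬ PostfixIn V₁ x (n - l)) → wordTail G V₁ V₂ P X v x u ≤ 1 - δ := by
  have hpos := gaussianReal_real_Iio_pos (-K)
  obtain ⟨m₀, p₀, hp₀, H⟩ := exists_forall_lt_hits_open (U := Set.Iio (-K)) isOpen_Iio
    (half_lt_self hpos)
  refine ⟨(gaussianReal 0 1).real (Set.Iio (-K)) / 2, max m₀ 1, p₀, by positivity, ?_, hp₀, ?_⟩
  · have : (gaussianReal 0 1).real (Set.Iio (-K)) ≤ 1 := measureReal_le_one
    linarith
  intro Ω _ N n m _ G V₁ V₂ _ d₁ P _ X V h hG hd₁ hd c hm j hj1 hj hp hm₀ u hu v x hx hx'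
  have hcard := card_closedNeighbors_eq_levelDegree hG hd₁ hd hj1 hj hx hx'
  have hmean := card_erase_mul_div hm v (levelDegree d₁ j)
  have hH := H P (Finset.univ.erase v) X (adjacencySection G V₁ V₂ x)
    (levelDegree d₁ j / (N : ℝ) ^ n) h.measurable_point (measurableSet_adjacencySection G V₁ V₂ x)
    h.indep_point (by intro i; rw [h.real_preimage_adjacencySection, hcard])
    (by rw [← hcard]; positivity) hp (by rw [hmean]; exact (le_max_left _ _).trans hm₀)
  rw [hmean] at hH
  have hsq : 0 < √(c * levelDegree d₁ j) :=
    Real.sqrt_pos.2 (zero_lt_one.trans_le ((le_max_right _ _).trans hm₀))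
  have hmeas : MeasurableSet {ω | u < hits (Finset.univ.erase v) X
      (adjacencySection G V₁ V₂ x) ω} :=
    measurableSet_lt measurable_const
      (measurable_hits h.measurable_point (measurableSet_adjacencySection G V₁ V₂ x))
  have h1 := probReal_compl_eq_one_sub (μ := P) hmeas
  have h2 : (gaussianReal 0 1).real (Set.Iio (-K)) / 2 ≤
      P.real {ω | u < hits (Finset.univ.erase v) X (adjacencySection G V₁ V₂ x) ω}ᶜ := by
    refine hH.le.trans (measureReal_mono fun ω hω => ?_)
    have hω' := (div_lt_iff₀ hsq).1 hω
    rw [Set.mem_compl_iff, Set.mem_ofPred_eq, not_lt]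
    linarith
  rw [h1] at h2
  change P.real _ ≤ _
  linarith

/-! ### Real inequalities comparing `ρ^j` with powers of `v`. -/

section Analysis

variable {d : ℕ}

theorem pow_le_levelDegree (hd : 2 ≤ d) (j : ℕ) : (d : ℝ) ^ j ≤ levelDegree d j := by
  rw [levelDegree_eq_sum hd]
  exact_mod_cast Finset.single_le_sum (f := fun l => d ^ l) (fun _ _ => Nat.zero_le _)
    (Finset.self_mem_range_succ j)

/-- Keeps the two largest terms of the geometric sum; the second supplies the slack in the lower
bound. -/
theorem mul_pow_le_levelDegree (hd : 2 ≤ d) {j : ℕ} (hj : 1 ≤ j) :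
    (1 + 1 / (d : ℝ)) * (d : ℝ) ^ j ≤ levelDegree d j := by
  have hd0 : (d : ℝ) ≠ 0 := by positivity
  obtain ⟨i, rfl⟩ := Nat.exists_eq_add_of_le' hj
  have h1 : (1 + 1 / (d : ℝ)) * (d : ℝ) ^ (i + 1) = ((d ^ (i + 1) + d ^ i : ℕ) : ℝ) := by
    push_cast
    field_simp
    ring
  rw [h1, levelDegree_eq_sum hd, Finset.sum_range_succ, Finset.sum_range_succ]
  push_cast
  have : (0 : ℝ) ≤ ∑ l ∈ Finset.range i, (d : ℝ) ^ l := by positivity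
  linarith

theorem levelDegree_le_pow (hd : 2 ≤ d) (j : ℕ) : levelDegree d j ≤ (d : ℝ) ^ (j + 1) := by
  have hd' : (2 : ℝ) ≤ d := by exact_mod_cast hd
  rw [levelDegree, div_le_iff₀ (by linarith)]
  nlinarith [pow_pos (by linarith : (0 : ℝ) < d) (j + 1)]

theorem eventually_exp_le_rpow {b C : ℝ} (hb : 0 < b) (hC : 0 < C) (s : ℝ) :
    ∀ᶠ y in atTop, Real.exp (-(b * y)) ≤ C * y ^ (-s) := by
  have h := tendsto_rpow_mul_exp_neg_mul_atTop_nhds_zero s b hb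
  filter_upwards [h.eventually_le_const hC, eventually_gt_atTop 0] with y h1 h2
  have h3 : 0 < y ^ s := Real.rpow_pos_of_pos h2 s
  rw [Real.rpow_neg h2.le, ← div_eq_mul_inv, le_div_iff₀ h3]
  calc _ = y ^ s * Real.exp (-b * y) := by rw [mul_comm, neg_mul]
    _ ≤ C := h1

theorem pow_rpow_neg {a g ρ : ℝ} (ha : 0 < a) (hρ : a ^ (-g) = ρ) (j : ℕ) :
    (a ^ j) ^ (-g) = ρ ^ j := by
  rw [← hρ, ← Real.rpow_natCast, ← Real.rpow_natCast, ← Real.rpow_mul ha.le, ← Real.rpow_mul ha.le,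
    mul_comm]

theorem one_add_mul_le_one_sub_rpow_neg {g x : ℝ} (hg : 0 ≤ g) (hx1 : x < 1) :
    1 + g * x ≤ (1 - x) ^ (-g) := by
  have h1 : 0 < 1 - x := by linarith
  rw [Real.rpow_def_of_pos h1]
  have h2 := Real.log_le_sub_one_of_pos h1
  have h3 := Real.add_one_le_exp (Real.log (1 - x) * -g)
  nlinarith

/-- The relative gap between `t_j` and `(1 + 1 / (2 d)) d ^ j`. -/
noncomputable def gap (d : ℕ) : ℝ := 1 / (2 * ((d : ℝ) + 1))

theorem gap_pos : 0 < gap d := by unfold gap; positivity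

theorem gap_le_one : gap d ≤ 1 := by
  unfold gap
  rw [div_le_one (by positivity)]
  have : (0 : ℝ) ≤ d := by positivity
  linarith

/-- `gap` solves `1 + 1/(2d) = (1 - gap)(1 + 1/d)`: half of the slack is left for Chernoff. -/
theorem mul_pow_le_one_sub_gap_mul (hd : 2 ≤ d) {j : ℕ} (hj : 1 ≤ j) :
    (1 + 1 / (2 * (d : ℝ))) * (d : ℝ) ^ j ≤ (1 - gap d) * levelDegree d j := by
  have hd0 : (0 : ℝ) < d := by positivity
  have h1 : (1 + 1 / (2 * (d : ℝ))) = (1 - gap d) * (1 + 1 / (d : ℝ)) := by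
    unfold gap
    field_simp
    ring
  rw [h1, mul_assoc]
  exact mul_le_mul_of_nonneg_left (mul_pow_le_levelDegree hd hj) (by linarith [gap_le_one (d := d)])

/-- Lower bound of the tail below the top level. -/
theorem lower_bound_of_lt {g ρ c v T : ℝ} (hd : 2 ≤ d) (hg : 0 < g)
    (hρ : (d : ℝ) ^ (-g) = ρ) (hc : 0 < c) {j : ℕ}
    (hv : (1 + 1 / (2 * (d : ℝ))) * (d : ℝ) ^ j ≤ v)
    (hE : Real.exp (-(gap d ^ 2 / 4 * (c * (d : ℝ) ^ j))) ≤ 1 - (1 + 1 / (2 * (d : ℝ))) ^ (-g))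
    (hT : ρ ^ (j + 1) * (1 - Real.exp (-(gap d ^ 2 / 4 * (c * levelDegree d (j + 1))))) ≤ T) :
    ((d : ℝ) * v) ^ (-g) ≤ T := by
  have hd0 : (0 : ℝ) < d := by positivity
  refine le_trans ?_ hT
  have hρ0 : 0 < ρ := hρ ▸ Real.rpow_pos_of_pos hd0 _
  calc ((d : ℝ) * v) ^ (-g) ≤ ((1 + 1 / (2 * (d : ℝ))) * (d : ℝ) ^ (j + 1)) ^ (-g) := by
        refine Real.rpow_le_rpow_of_nonpos (by positivity) ?_ (by linarith)
        calc _ = (d : ℝ) * ((1 + 1 / (2 * (d : ℝ))) * (d : ℝ) ^ j) := by ring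
          _ ≤ _ := by gcongr
    _ = ρ ^ (j + 1) * (1 + 1 / (2 * (d : ℝ))) ^ (-g) := by
        rw [Real.mul_rpow (by positivity) (by positivity), pow_rpow_neg hd0 hρ, mul_comm]
    _ ≤ _ := by
        gcongr
        have h1 : Real.exp (-(gap d ^ 2 / 4 * (c * levelDegree d (j + 1))))
            ≤ Real.exp (-(gap d ^ 2 / 4 * (c * (d : ℝ) ^ j))) := by
          gcongr
          refine le_trans ?_ (pow_le_levelDegree hd _)
          exact pow_le_pow_right₀ (by exact_mod_cast (by omega : 1 ≤ d)) (by omega)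
        linarith

/-- Upper bound of the tail near `c t_j`. -/
theorem upper_bound_near {g ρ c v T κ δ ε : ℝ} (hd : 2 ≤ d) (hg : 0 < g)
    (hρ : (d : ℝ) ^ (-g) = ρ) (hρ2 : ρ ≤ 1 / 2) (hε : 0 < ε) (hc : ε ≤ c) {j : ℕ} (hv0 : 0 < v)
    (hδ : 0 ≤ δ) (hκ0 : 0 < κ) (hκ : κ ^ (-g) = 1 - δ / 4) (hv : v ≤ κ * levelDegree d j)
    {b : ℝ}
    (hE : Real.exp (-(b * (c * (d : ℝ) ^ j))) ≤
      (δ / 4 * ε ^ g) * (c * (d : ℝ) ^ j) ^ (-g))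
    (hT : T ≤ ρ ^ j * (1 - δ) + ρ ^ (j + 1) * (1 - (1 - δ)) + Real.exp (-(b * (c * (d : ℝ) ^ j)))) :
    T ≤ (v / d) ^ (-g) := by
  have hd0 : (0 : ℝ) < d := by positivity
  have hρ0 : 0 < ρ := hρ ▸ Real.rpow_pos_of_pos hd0 _
  have hc0 : 0 < c := hε.trans_le hc
  have h1 : ρ ^ j * (1 - δ / 4) ≤ (v / d) ^ (-g) := by
    rw [← hκ, ← pow_rpow_neg hd0 hρ, ← Real.mul_rpow (by positivity) hκ0.le]
    refine Real.rpow_le_rpow_of_nonpos (by positivity) ?_ (by linarith)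
    rw [div_le_iff₀ hd0]
    have := levelDegree_le_pow hd j
    calc v ≤ κ * levelDegree d j := hv
      _ ≤ κ * (d : ℝ) ^ (j + 1) := by gcongr
      _ = _ := by ring
  -- The factor `ε^g` absorbs `c^(-g)`, because `c ≥ ε`.
  have h2 : (δ / 4 * ε ^ g) * (c * (d : ℝ) ^ j) ^ (-g) ≤ δ / 4 * ρ ^ j := by
    rw [mul_assoc, ← pow_rpow_neg hd0 hρ, Real.mul_rpow hc0.le (by positivity)]
    refine mul_le_mul_of_nonneg_left ?_ (by positivity)
    rw [← mul_assoc]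
    have h3 : ε ^ g * c ^ (-g) ≤ 1 := by
      calc ε ^ g * c ^ (-g) ≤ c ^ g * c ^ (-g) := by gcongr
        _ = 1 := by rw [← Real.rpow_add hc0]; simp
    calc _ ≤ 1 * ((d : ℝ) ^ j) ^ (-g) := by gcongr
      _ = _ := one_mul _
  -- Budget in units of `ρ^j`: `(1 - δ) + δ/2 + δ/4 = 1 - δ/4`.
  have h4 : ρ ^ (j + 1) ≤ ρ ^ j * (1 / 2) := by
    rw [pow_succ]
    gcongr
  nlinarith

/-- Upper bound of the tail between two levels. -/
theorem upper_bound_between {g ρ c v T K ε : ℝ} (hd : 2 ≤ d) (hg : 0 < g)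
    (hρ : (d : ℝ) ^ (-g) = ρ) (hε : 0 < ε) (hc : ε ≤ c) {j : ℕ} (hv0 : 0 < v) (hK : 1 ≤ K)
    (hv : c * v ≤ c * levelDegree d (j + 1) - K * √(c * levelDegree d (j + 1))) {b : ℝ}
    (hE : Real.exp (-(b * (c * (d : ℝ) ^ j))) ≤
      (((d : ℝ) / ε) ^ (-g) * (g / d)) * (c * (d : ℝ) ^ j) ^ (-(g + 1 / 2)))
    (hT : T ≤ ρ ^ (j + 1) + Real.exp (-(b * (c * (d : ℝ) ^ j)))) :
    T ≤ (v / d) ^ (-g) := by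
  have hd0 : (0 : ℝ) < d := by positivity
  have hρ0 : 0 < ρ := hρ ▸ Real.rpow_pos_of_pos hd0 _
  have hc0 : 0 < c := hε.trans_le hc
  have ht0 : 0 < levelDegree d (j + 1) := (by positivity : 0 < (d : ℝ) ^ (j + 1)).trans_le
    (pow_le_levelDegree hd _)
  set μ := c * levelDegree d (j + 1) with hμ
  have hμ0 : 0 < μ := by positivity
  have hsq : 0 < √μ := Real.sqrt_pos.2 hμ0
  have hsq2 : √μ * √μ = μ := Real.mul_self_sqrt hμ0.le
  -- As `K ≥ 1`, `v` is at most `t_{j+1}(1 - x)`. This gains `g x ρ^(j+1)`, a power of the mean,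
  -- which outweighs the exponential error.
  set x := 1 / √μ with hx
  have hx0 : 0 < x := by positivity
  have hxμ : √μ = x * μ := by
    rw [hx, one_div, ← div_eq_inv_mul, eq_div_iff hsq.ne', hsq2]
  have hcv : c * v ≤ c * (levelDegree d (j + 1) * (1 - x)) := by
    have : √μ ≤ K * √μ := le_mul_of_one_le_left hsq.le hK
    calc c * v ≤ μ - √μ := by linarith
      _ = c * (levelDegree d (j + 1) * (1 - x)) := by rw [hxμ, hμ]; ring
  have hvx : v ≤ levelDegree d (j + 1) * (1 - x) := le_of_mul_le_mul_left hcv hc0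
  have hx1 : x < 1 := by
    by_contra hcon
    have : levelDegree d (j + 1) * (1 - x) ≤ 0 :=
      mul_nonpos_of_nonneg_of_nonpos ht0.le (by linarith)
    linarith
  have h1 : ρ ^ (j + 1) * (1 + g * x) ≤ (v / d) ^ (-g) := by
    calc ρ ^ (j + 1) * (1 + g * x) ≤ ρ ^ (j + 1) * (1 - x) ^ (-g) := by
          gcongr
          exact one_add_mul_le_one_sub_rpow_neg hg.le hx1
      _ = ((d : ℝ) ^ (j + 1) * (1 - x)) ^ (-g) := by
          rw [Real.mul_rpow (by positivity) (by linarith), pow_rpow_neg hd0 hρ]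
      _ ≤ _ := by
          refine Real.rpow_le_rpow_of_nonpos (by positivity) ?_ (by linarith)
          rw [div_le_iff₀ hd0]
          refine hvx.trans ?_
          have := levelDegree_le_pow hd (j + 1)
          have h3 : levelDegree d (j + 1) * (1 - x) ≤ (d : ℝ) ^ (j + 1 + 1) * (1 - x) :=
            mul_le_mul_of_nonneg_right this (by linarith)
          calc _ ≤ _ := h3
            _ = _ := by ring
  set y := c * (d : ℝ) ^ j with hy
  have hy0 : 0 < y := by positivity
  have h2 : (((d : ℝ) / ε) ^ (-g) * (g / d)) * y ^ (-(g + 1 / 2)) ≤ ρ ^ (j + 1) * (g * x) := by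
    have hsy : √μ ≤ d * √y := by
      have : μ ≤ (d : ℝ) ^ 2 * y := by
        have := levelDegree_le_pow hd (j + 1)
        calc μ ≤ c * (d : ℝ) ^ (j + 1 + 1) := by rw [hμ]; gcongr
          _ = _ := by rw [hy]; ring
      calc √μ ≤ √((d : ℝ) ^ 2 * y) := Real.sqrt_le_sqrt this
        _ = _ := by rw [Real.sqrt_mul (by positivity), Real.sqrt_sq hd0.le]
    have hr : ((d : ℝ) / ε * y) ^ (-g) ≤ ρ ^ (j + 1) := by
      rw [← pow_rpow_neg hd0 hρ]
      refine Real.rpow_le_rpow_of_nonpos (by positivity) ?_ (by linarith)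
      calc (d : ℝ) ^ (j + 1) = (d / ε) * (ε * (d : ℝ) ^ j) := by field_simp; ring
        _ ≤ _ := by rw [hy]; gcongr
    have hsplit : y ^ (-(g + 1 / 2)) = y ^ (-g) * (1 / √y) := by
      rw [neg_add, Real.rpow_add hy0, Real.sqrt_eq_rpow, one_div (y ^ _), ← Real.rpow_neg hy0.le]
    calc _ = ((d : ℝ) / ε * y) ^ (-g) * (g * (1 / (d * √y))) := by
          rw [hsplit, Real.mul_rpow (by positivity) hy0.le]
          field_simp
      _ ≤ _ := by rw [hx]; gcongr
  linarith

end Analysis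

/-- Locates `u` between consecutive levels without monotonicity, which `c t_j - K √(c t_j)` need not
have. -/
theorem exists_last_le {f : ℕ → ℝ} {v : ℝ} {k n : ℕ} (hkn : k ≤ n) (hk : f k ≤ v) :
    ∃ j, k ≤ j ∧ j ≤ n ∧ f j ≤ v ∧ (j = n ∨ v < f (j + 1)) := by
  induction n, hkn using Nat.le_induction with
  | base => exact ⟨k, le_rfl, le_rfl, hk, Or.inl rfl⟩
  | succ n _ ih =>
    by_cases h : f (n + 1) ≤ v
    · exact ⟨n + 1, by omega, le_rfl, h, Or.inl rfl⟩
    · obtain ⟨j, h1, h2, h3, h4⟩ := ih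
      refine ⟨j, h1, by omega, h3, Or.inr ?_⟩
      rcases h4 with rfl | h4
      · exact not_le.1 h
      · exact h4

/-- For `d₂ ≥ 2` the geometric sum is below `d₂^(n+1) < d₁^k`; for `d₂ = 1` it is `n + 1`, handled
by the logarithmic term. That term also makes the means grow with `n`. -/
theorem levelThreshold_spec {d₁ d₂ n k : ℕ} (hd₂ : 1 ≤ d₂) (hd : d₂ + 1 ≤ d₁) (hn : 1 ≤ n)
    (hk : levelThreshold d₁ d₂ n < k) :
    1 ≤ k ∧ n < d₁ ^ k ∧ ∑ l ∈ Finset.range (n + 1), d₂ ^ l ≤ d₁ ^ k := by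
  have hd1 : (1 : ℝ) < d₁ := by exact_mod_cast (by omega : 1 < d₁)
  have hlog : 0 < Real.log d₁ := Real.log_pos hd1
  obtain ⟨h1, h2⟩ := max_lt_iff.1 hk
  have hpow : Real.log ((d₁ : ℝ) ^ k) = k * Real.log d₁ := Real.log_pow _ _
  have hn' : n < d₁ ^ k := by
    rw [div_lt_iff₀ hlog, ← hpow] at h2
    have := (Real.log_lt_log_iff (by exact_mod_cast hn) (by positivity)).1 h2
    exact_mod_cast this
  have hd₂' : d₂ ^ (n + 1) < d₁ ^ k := by
    rw [← mul_div_assoc, div_lt_iff₀ hlog, ← hpow] at h1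
    have h3 : ((n : ℝ) + 1) * Real.log d₂ = Real.log ((d₂ : ℝ) ^ (n + 1)) := by
      rw [Real.log_pow]; push_cast; ring
    rw [h3] at h1
    have hd20 : (0 : ℝ) < d₂ := by exact_mod_cast hd₂
    have := (Real.log_lt_log_iff (by positivity) (by positivity)).1 h1
    exact_mod_cast this
  refine ⟨?_, hn', ?_⟩
  · by_contra hk0
    have : k = 0 := by omega
    subst this
    rw [pow_zero] at hn'
    omega
  · rcases hd₂.eq_or_lt with rfl | hlt
    · simpa using hn'
    · refine le_trans ?_ hd₂'.le
      exact (Nat.geomSum_lt hlt fun l hl => by simpa using hl).le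

/-! ### Degree counts in the base graph and choice of constants. -/

section GraphCounts

variable {N : ℕ} {G : SimpleGraph (Fin N)} [DecidableRel G.Adj] {V₁ V₂ : Finset (Fin N)}
  {d₁ d₂ : ℕ}

theorem one_le_right_degree (hV₁ : V₁.Nonempty)
    (hG : G.IsBipartiteWith (V₁ : Set (Fin N)) (V₂ : Set (Fin N)))
    (hd₁ : ∀ x ∈ V₁, G.degree x = d₁) (hd₂ : ∀ y ∈ V₂, G.degree y ≤ d₂) (hd : d₂ + 1 ≤ d₁) :
    1 ≤ d₂ := by
  obtain ⟨x, hx⟩ := hV₁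
  have hpos : 0 < G.degree x := by rw [hd₁ x hx]; omega
  obtain ⟨y, hy⟩ := (G.degree_pos_iff_exists_adj x).1 hpos
  have hy2 : y ∈ V₂ := by exact_mod_cast hG.mem_of_mem_adj (by exact_mod_cast hx) hy
  exact ((G.degree_pos_iff_exists_adj y).2 ⟨x, hy.symm⟩).trans_le (hd₂ y hy2)

omit [DecidableRel G.Adj] in
theorem card_add_card_eq (hV : V₁ ∪ V₂ = Finset.univ)
    (hG : G.IsBipartiteWith (V₁ : Set (Fin N)) (V₂ : Set (Fin N))) : V₁.card + V₂.card = N := by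
  rw [← Finset.card_union_of_disjoint (by exact_mod_cast hG.disjoint), hV, Finset.card_univ,
    Fintype.card_fin]

/-- Counting edges from both sides gives `n₁ d₁ ≤ n₂ d₂`. This is the source of `ρ < 1/2`. -/
theorem card_left_lt_card_right (hV₁ : V₁.Nonempty)
    (hG : G.IsBipartiteWith (V₁ : Set (Fin N)) (V₂ : Set (Fin N)))
    (hd₁ : ∀ x ∈ V₁, G.degree x = d₁) (hd₂ : ∀ y ∈ V₂, G.degree y ≤ d₂) (hd : d₂ + 1 ≤ d₁) :
    V₁.card < V₂.card := by
  have h := SimpleGraph.isBipartiteWith_sum_degrees_eq hG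
  rw [Finset.sum_congr rfl hd₁, Finset.sum_const, smul_eq_mul] at h
  have h2 : V₁.card * d₁ ≤ V₂.card * d₂ := by
    rw [h]
    exact (Finset.sum_le_card_nsmul _ _ _ hd₂).trans (by rw [smul_eq_mul])
  have h3 := hV₁.card_pos
  by_contra hcon
  nlinarith

theorem left_degree_le_card_right (hV₁ : V₁.Nonempty)
    (hG : G.IsBipartiteWith (V₁ : Set (Fin N)) (V₂ : Set (Fin N)))
    (hd₁ : ∀ x ∈ V₁, G.degree x = d₁) : d₁ ≤ V₂.card := by
  obtain ⟨x, hx⟩ := hV₁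
  rw [← hd₁ x hx]
  exact SimpleGraph.isBipartiteWith_degree_le hG hx

end GraphCounts

theorem tendsto_pow_succ_div_pow {d N : ℕ} (hdN : d < N) :
    Tendsto (fun n : ℕ => (d : ℝ) ^ (n + 1) / (N : ℝ) ^ n) atTop (nhds 0) := by
  have hN : (0 : ℝ) < N := by exact_mod_cast (by omega : 0 < N)
  have h := (tendsto_pow_atTop_nhds_zero_of_lt_one (r := (d : ℝ) / N) (by positivity)
    (by rw [div_lt_one hN]; exact_mod_cast hdN)).const_mul (d : ℝ)
  rw [mul_zero] at h
  refine h.congr fun n => ?_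
  rw [div_pow, pow_succ]
  ring

theorem mul_sqrt_le_mul {K η μ : ℝ} (hη : 0 < η) (hμ : (K / η) ^ 2 ≤ μ) :
    K * √μ ≤ η * μ := by
  have hμ0 : 0 ≤ μ := (sq_nonneg _).trans hμ
  have h1 : K / η ≤ √μ := Real.le_sqrt_of_sq_le hμ
  rw [div_le_iff₀ hη] at h1
  calc K * √μ ≤ (√μ * η) * √μ := by gcongr
    _ = η * (√μ * √μ) := by ring
    _ = η * μ := by rw [Real.mul_self_sqrt hμ0]

theorem exists_one_lt_rpow_neg_eq {g δ : ℝ} (hg : 0 < g) (hδ0 : 0 < δ) (hδ1 : δ ≤ 1) :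
    ∃ κ : ℝ, 1 < κ ∧ κ ^ (-g) = 1 - δ / 4 := by
  have h0 : 0 < 1 - δ / 4 := by linarith
  refine ⟨(1 - δ / 4) ^ (-(1 / g)), Real.one_lt_rpow_of_pos_of_lt_one_of_neg h0 (by linarith)
    (by simpa using hg), ?_⟩
  rw [← Real.rpow_mul h0.le]
  have : -(1 / g) * -g = 1 := by field_simp
  rw [this, Real.rpow_one]

/-- One more trailing letter in `V₁` costs a factor `ρ` in mass and multiplies the degree by about
`d`; the exponent balances the two. -/
theorem rpow_neg_powerExponent {N n₁ d : ℕ} (hd : 2 ≤ d) (hn₁ : 0 < n₁) (hN : 0 < N) :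
    (d : ℝ) ^ (-(powerExponent N n₁ d - 1)) = (n₁ : ℝ) / N := by
  have hd1 : (1 : ℝ) < d := by exact_mod_cast (by omega : 1 < d)
  have hlog : Real.log d ≠ 0 := (Real.log_pos hd1).ne'
  have hn₁' : (0 : ℝ) < n₁ := by exact_mod_cast hn₁
  have hN' : (0 : ℝ) < N := by exact_mod_cast hN
  rw [Real.rpow_def_of_pos (by linarith), powerExponent]
  have : Real.log d * -(1 + Real.log ((N : ℝ) / n₁) / Real.log d - 1)
      = Real.log ((n₁ : ℝ) / N) := by
    rw [← inv_div (N : ℝ), Real.log_inv]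
    field_simp
    ring
  rw [this, Real.exp_log (by positivity)]

/-- A two-sided power bound, rewritten as a bound on the slowly varying factor. -/
theorem factor_bounds {a g ρ v T : ℝ} (ha : 0 < a) (hv : 0 < v) (hρ : a ^ (-g) = ρ)
    (hlow : (a * v) ^ (-g) ≤ T) (hup : T ≤ (v / a) ^ (-g)) :
    T = v ^ (-g) * (T * v ^ g) ∧ ρ ≤ T * v ^ g ∧ T * v ^ g ≤ ρ⁻¹ := by
  have hvg : 0 < v ^ g := Real.rpow_pos_of_pos hv g
  have hvv : v ^ (-g) * v ^ g = 1 := by rw [← Real.rpow_add hv]; simp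
  refine ⟨?_, ?_, ?_⟩
  · calc T = T * (v ^ (-g) * v ^ g) := by rw [hvv, mul_one]
      _ = _ := by ring
  · calc ρ = (a * v) ^ (-g) * v ^ g := by
          rw [Real.mul_rpow ha.le hv.le, mul_assoc, hvv, mul_one, hρ]
      _ ≤ _ := by gcongr
  · calc T * v ^ g ≤ (v / a) ^ (-g) * v ^ g := by gcongr
      _ = ρ⁻¹ := by
        rw [Real.div_rpow hv.le ha.le, hρ, div_mul_eq_mul_div, hvv, one_div]

end HierarchicalGraph

/-! ### Assembly of the two-sided bound. -/

open HierarchicalGraph in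
theorem mainTheorem9
    {N : ℕ} (G : SimpleGraph (Fin N)) [DecidableRel G.Adj]
    (V₁ V₂ : Finset (Fin N)) (hV₁ : V₁.Nonempty) (hV₂ : V₂.Nonempty)
    (hV : V₁ ∪ V₂ = Finset.univ)
    (hG : G.IsBipartiteWith (V₁ : Set (Fin N)) (V₂ : Set (Fin N)))
    (d₁ d₂ : ℕ) (hd₁ : ∀ x ∈ V₁, G.degree x = d₁)
    (hd₂ : IsGreatest ((fun y => G.degree y) '' (V₂ : Set (Fin N))) d₂)
    (hd : d₂ + 1 ≤ d₁)
    (M : ℕ → ℕ) (c : ℕ → ℝ) (hM : ∀ n, (M n : ℝ) = c n * (N : ℝ) ^ n)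
    (ε : ℝ) (hε : 0 < ε) (hc : ∀ᶠ n in atTop, ε ≤ c n)
    {Ω : Type*} [MeasurableSpace Ω] (P : Measure Ω) [IsProbabilityMeasure P]
    (X : (n : ℕ) → Fin (M n + 1) → Ω → ℝ) (hXmeas : ∀ n i, Measurable (X n i))
    (hXlaw : ∀ n i, P.map (X n i) = volume.restrict (Set.Icc (0 : ℝ) 1))
    (hXindep : ∀ n, iIndepFun (X n) P)
    (V : (n : ℕ) → Ω → Fin (M n + 1)) (hVmeas : ∀ n, Measurable (V n))
    (hVlaw : ∀ n, P.map (V n) = uniformOn Set.univ)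
    (hVindep : ∀ n, IndepFun (V n) (fun ω i => X n i ω) P)
    (K : ℝ) :
    ∀ᶠ n in atTop, ∃ L : ℝ → ℝ, ∀ (k : ℕ) (u : ℝ),
      HierarchicalGraph.levelThreshold d₁ d₂ n < k → k ≤ n →
      c n * HierarchicalGraph.levelDegree d₁ k
        - K * Real.sqrt (c n * HierarchicalGraph.levelDegree d₁ k) ≤ u →
      u ≤ c n * HierarchicalGraph.levelDegree d₁ n →
      P.real {ω | u < (HierarchicalGraph.pointDegree G V₁ V₂ n (fun i => X n i ω) (V n ω) : ℝ)}
          = (u / c n) ^ (-(HierarchicalGraph.powerExponent N V₁.card d₁ - 1)) * L u ∧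
        (V₁.card : ℝ) / N ≤ L u ∧ L u ≤ (N : ℝ) / V₁.card := by
  have hdeg₂ : ∀ y ∈ V₂, G.degree y ≤ d₂ := fun y hy => hd₂.2 ⟨y, hy, rfl⟩
  have hd₂1 : 1 ≤ d₂ := one_le_right_degree hV₁ hG hd₁ hdeg₂ hd
  have hd2 : 2 ≤ d₁ := by omega
  have hn₁ := hV₁.card_pos
  have hcard := card_add_card_eq hV hG
  have hlt := card_left_lt_card_right hV₁ hG hd₁ hdeg₂ hd
  have hdN : d₁ < N := by
    have := left_degree_le_card_right hV₁ hG hd₁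
    omega
  have hN0 : 0 < N := by omega
  have : NeZero N := ⟨hN0.ne'⟩
  have hd0 : (0 : ℝ) < d₁ := by positivity
  set ρ : ℝ := (V₁.card : ℝ) / N with hρdef
  set g : ℝ := powerExponent N V₁.card d₁ - 1 with hgdef
  have hρ : (d₁ : ℝ) ^ (-g) = ρ := rpow_neg_powerExponent hd2 hn₁ hN0
  have hNR : (0 : ℝ) < N := by exact_mod_cast hN0
  have hρ0 : 0 < ρ := by positivity
  have hρ2 : ρ < 1 / 2 := by
    rw [hρdef, div_lt_div_iff₀ hNR two_pos, one_mul]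
    exact_mod_cast (by omega : V₁.card * 2 < N)
  have hg : 0 < g := by
    by_contra hcon
    have : 1 ≤ (d₁ : ℝ) ^ (-g) :=
      Real.one_le_rpow (by exact_mod_cast (by omega : 1 ≤ d₁)) (by linarith)
    linarith
  set β : ℝ := 1 + 1 / (2 * (d₁ : ℝ)) with hβ
  have hβ1 : 1 < β := by rw [hβ]; linarith [(by positivity : 0 < 1 / (2 * (d₁ : ℝ)))]
  have hβg : 0 < 1 - β ^ (-g) := by
    linarith [Real.rpow_lt_one_of_one_lt_of_neg hβ1 (by linarith : -g < 0)]
  -- Enlarging `K` only widens the window, and `K' ≥ 1` is what the estimate between levels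
  -- requires.
  set K' : ℝ := max K 1 with hK'
  have hK1 : 1 ≤ K' := le_max_right _ _
  obtain ⟨mA, pA, hpA, hA⟩ := exists_forall_le_degreeTail hρ2
  obtain ⟨δ, mB, pB, hδ0, hδ1, hpB, hB⟩ := exists_forall_wordTail_le K'
  obtain ⟨κ, hκ1, hκ⟩ := exists_one_lt_rpow_neg_eq hg hδ0 hδ1
  set η : ℝ := min 1 (κ - 1) with hη
  have hη0 : 0 < η := lt_min one_pos (by linarith)
  set θ : ℝ := 1 / (2 * (d₁ : ℝ)) with hθ
  have hθ0 : 0 < θ := by positivity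
  have hθ1 : θ ≤ 1 := by
    rw [hθ, div_le_one (by positivity)]
    have : (2 : ℝ) ≤ d₁ := by exact_mod_cast hd2
    linarith
  have hE₁ := eventually_exp_le_rpow (b := gap d₁ ^ 2 / 4) (by have := gap_pos (d := d₁); positivity)
    hβg 0
  have hE₂ := eventually_exp_le_rpow (b := θ ^ 2 / 4) (C := δ / 4 * ε ^ g) (by positivity)
    (by positivity) g
  have hE₃ := eventually_exp_le_rpow (b := η ^ 2 / 4) (C := ((d₁ : ℝ) / ε) ^ (-g) * (g / d₁))
    (by positivity) (by positivity) (g + 1 / 2)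
  -- One threshold `Y` for all size conditions. It is met uniformly in the level, since `c_n d₁^j ≥
  -- ε n` for `j ≥ k`.
  obtain ⟨Y, hY⟩ := eventually_atTop.1 (hE₁.and (hE₂.and (hE₃.and ((eventually_ge_atTop mA).and
    ((eventually_ge_atTop mB).and (eventually_ge_atTop ((K' / gap d₁) ^ 2)))))))
  have hlim := tendsto_pow_succ_div_pow hdN
  have hnε : ∀ᶠ n : ℕ in atTop, Y ≤ ε * n :=
    (tendsto_natCast_atTop_atTop.const_mul_atTop hε).eventually_ge_atTop Y
  filter_upwards [hc, hlim.eventually_le_const hpA, hlim.eventually_le_const hpB, hnε,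
    eventually_ge_atTop 1] with n hcn hpAn hpBn hYn hn1
  have hc0 : 0 < c n := hε.trans_le hcn
  have hS : IsUniformSample P (X n) (V n) :=
    ⟨hXmeas n, hXlaw n, hXindep n, hVmeas n, hVlaw n, hVindep n⟩
  refine ⟨fun u => degreeTail G V₁ V₂ n P (X n) (V n) u * (u / c n) ^ g, fun k u hk hkn hku hun => ?_⟩
  obtain ⟨hk1, hnk, hsum⟩ := levelThreshold_spec hd₂1 hd hn1 hk
  set t : ℕ → ℝ := levelDegree d₁ with ht
  have hpow_mono : ∀ j, k ≤ j → (d₁ : ℝ) ^ k ≤ (d₁ : ℝ) ^ j := fun j hj =>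
    pow_le_pow_right₀ (by exact_mod_cast (by omega : 1 ≤ d₁)) hj
  have hYj : ∀ j, k ≤ j → Y ≤ c n * (d₁ : ℝ) ^ j := by
    intro j hj
    have h1 : (n : ℝ) ≤ (d₁ : ℝ) ^ k := by exact_mod_cast hnk.le
    calc Y ≤ ε * n := hYn
      _ ≤ c n * (d₁ : ℝ) ^ j := by
        gcongr
        exact h1.trans (hpow_mono j hj)
  have hYt : ∀ j, k ≤ j → Y ≤ c n * t j := fun j hj =>
    (hYj j hj).trans (by gcongr; exact pow_le_levelDegree hd2 j)
  have htp : ∀ j, j ≤ n → t j / (N : ℝ) ^ n ≤ (d₁ : ℝ) ^ (n + 1) / (N : ℝ) ^ n := by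
    intro j hj
    gcongr
    exact (levelDegree_le_pow hd2 j).trans
      (pow_le_pow_right₀ (by exact_mod_cast (by omega : 1 ≤ d₁)) (by omega))
  have hku' : c n * t k - K' * √(c n * t k) ≤ u := by
    have : K * √(c n * t k) ≤ K' * √(c n * t k) :=
      mul_le_mul_of_nonneg_right (le_max_left _ _) (Real.sqrt_nonneg _)
    linarith
  -- For a large mean, `K'` standard deviations fit into the relative gap between `t_j` and `β
  -- d₁^j`.
  have hbeta : ∀ j, k ≤ j → c n * t j - K' * √(c n * t j) ≤ u → c n * (β * (d₁ : ℝ) ^ j) ≤ u := by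
    intro j hj hu
    have h1 := mul_sqrt_le_mul (gap_pos (d := d₁))
      (hY _ (hYt j hj)).2.2.2.2.2
    have h2 := mul_le_mul_of_nonneg_left (mul_pow_le_one_sub_gap_mul hd2 (hk1.trans hj)) hc0.le
    calc _ ≤ _ := h2
      _ = c n * t j - gap d₁ * (c n * t j) := by ring
      _ ≤ u := by linarith
  have hvk := hbeta k le_rfl hku'
  have hu0 : 0 < u := lt_of_lt_of_le (by positivity) hvk
  have hv0 : 0 < u / c n := by positivity
  have hcv : c n * (u / c n) = u := by field_simp
  have hsumR : ∀ j, k ≤ j →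
      ((∑ l ∈ Finset.range (n + 1), d₂ ^ l : ℕ) : ℝ) ≤ (d₁ : ℝ) ^ j := fun j hj =>
    le_trans (by exact_mod_cast hsum) (hpow_mono j hj)
  have hlow : ((d₁ : ℝ) * (u / c n)) ^ (-g) ≤ degreeTail G V₁ V₂ n P (X n) (V n) u := by
    obtain ⟨j, hkj, hjn, hj, hj'⟩ := exists_last_le (f := fun j => c n * (β * (d₁ : ℝ) ^ j)) hkn hvk
    have hvj : β * (d₁ : ℝ) ^ j ≤ u / c n := by rw [le_div_iff₀' hc0]; exact hj
    rcases hjn.eq_or_lt with rfl | hjn'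
    -- At the top no deeper words help, and `u` may equal the mean `c t_n`. The central limit
    -- theorem still gives `ρ^n · ρ`.
    · refine le_trans ?_ (hA hS hG hd₁ hd2 (hM j) hn1 ((htp j le_rfl).trans hpAn)
        (hY _ (hYt j hkj)).2.2.2.1 hun)
      calc ((d₁ : ℝ) * (u / c j)) ^ (-g) ≤ ((d₁ : ℝ) ^ (j + 1)) ^ (-g) := by
            refine Real.rpow_le_rpow_of_nonpos (by positivity) ?_ (by linarith)
            rw [pow_succ']
            gcongr
            refine le_trans ?_ hvj
            exact le_mul_of_one_le_left (by positivity) hβ1.le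
        _ = ρ ^ j * ρ := by rw [pow_rpow_neg hd0 hρ, pow_succ]
    · refine lower_bound_of_lt hd2 hg hρ hc0 hvj ?_
        (hS.le_degreeTail_of_le hG hd₁ hd2 hc0.le (hM n) hjn' gap_pos.le gap_le_one ?_)
      · have h1 := (hY _ (hYj j hkj)).1
        rwa [neg_zero, Real.rpow_zero, mul_one] at h1
      · refine ((hj'.resolve_left hjn'.ne).le).trans ?_
        calc _ ≤ c n * ((1 - gap d₁) * t (j + 1)) :=
              mul_le_mul_of_nonneg_left (mul_pow_le_one_sub_gap_mul hd2 (by omega)) hc0.le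
          _ = _ := by ring
  have hup : degreeTail G V₁ V₂ n P (X n) (V n) u ≤ (u / c n / d₁) ^ (-g) := by
    obtain ⟨j, hkj, hjn, hj, hj'⟩ :=
      exists_last_le (f := fun j => c n * t j - K' * √(c n * t j)) hkn hku'
    have htj0 : 0 < t j := (by positivity : 0 < (d₁ : ℝ) ^ j).trans_le (pow_le_levelDegree hd2 j)
    -- Up to `κ t_j` the chance `δ` of falling short pays for the factor `κ^(-g)`; beyond it words
    -- of level at most `j` are exponentially unlikely.
    by_cases hnear : u ≤ c n * (κ * t j)
    · refine upper_bound_near (b := θ ^ 2 / 4) hd2 hg hρ hρ2.le hε hcn hv0 hδ0.le (by linarith) hκ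
        (by rw [div_le_iff₀' hc0]; exact hnear) (hY _ (hYj j hkj)).2.1 ?_
      obtain ⟨i, rfl⟩ := Nat.exists_eq_add_of_le' (hk1.trans hkj)
      refine hS.degreeTail_le_add_exp hG hd₁ hdeg₂ hd2 hc0.le (hM n) hjn hθ0.le hθ1 (by linarith)
        (levelDegree_le_pow hd2 i) (hsumR _ hkj) ?_ ?_
      · refine le_trans (le_of_eq ?_) (hbeta _ hkj hj)
        ring
      · exact hB hS hG hd₁ hd2 (hM n) (by omega) hjn ((htp _ hjn).trans hpBn)
          (hY _ (hYt _ hkj)).2.2.2.2.1 hj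
    · push Not at hnear
      have hjn' : j ≠ n := by
        rintro rfl
        have : c j * t j ≤ c j * (κ * t j) := by
          gcongr
          exact le_mul_of_one_le_left htj0.le hκ1.le
        linarith
      refine upper_bound_between (b := η ^ 2 / 4) (K := K') (j := j) hd2 hg hρ hε hcn hv0 hK1
        (by rw [hcv]; exact (hj'.resolve_left hjn').le) (hY _ (hYj j hkj)).2.2.1 ?_
      -- With `q = 1` all words of level at least `j + 1` are charged in full, leaving `ρ^(j+1)`.
      have h1 := hS.degreeTail_le_add_exp (q := 1) (η := η) (D := t j) (u := u) hG hd₁ hdeg₂ hd2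
        hc0.le (hM n) (by omega) hη0.le (min_le_left _ _) le_rfl le_rfl
        ((hsumR j hkj).trans (pow_le_levelDegree hd2 j)) ?_ fun v x _ _ => measureReal_le_one
      · refine h1.trans ?_
        have h2 : Real.exp (-(η ^ 2 / 4 * (c n * t j)))
            ≤ Real.exp (-(η ^ 2 / 4 * (c n * (d₁ : ℝ) ^ j))) := by
          gcongr
          exact pow_le_levelDegree hd2 j
        rw [sub_self, mul_zero, add_zero, mul_one]
        linarith
      · refine le_trans ?_ hnear.le
        have : 1 + η ≤ κ := by linarith [min_le_right 1 (κ - 1)]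
        calc (1 + η) * (c n * t j) ≤ κ * (c n * t j) := by gcongr
          _ = _ := by ring
  have hfac := factor_bounds hd0 hv0 hρ hlow hup
  rw [hρdef, inv_div] at hfac
  exact hfac
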